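/- Let $\mathbb{T}^\infty$ be the countable product of the unit circle $\mathbb{T}\subset\mathbb{C}$ with the product $m$ of the normalized Lebesgue measures. For $f\in L_\infty(\mathbb{T}^\infty)$ and $\alpha\in\mathbb{Z}^{(\mathbb{N})}$ (finitely supported integer sequences) put $\hat f(\alpha)=\int_{\mathbb{T}^\infty} f(w)\,w^{-\alpha}\,dm(w)$. Let $$H_\infty(\mathbb{T}^\infty)=\{f\in L_\infty(\mathbb{T}^\infty):\ \hat f(\alpha)=0\ \text{ for all } \alpha\in\mathbb{Z}^{(\mathbb{N})}\setminus\mathbb{N}_0^{(\mathbb{N})}\}$$ with the $L_\infty$-norm, and for $k\in\mathbb{N}_0$ let $H_\infty^k(\mathbb{T}^\infty)=\{f\in H_\infty(\mathbb{T}^\infty):\ \hat f(\alpha)\ne 0\Rightarrow|\alpha|=k\}$. Let $\mathbb{D}_0^\infty$ be the open unit ball of $c_0$ and $H_\infty(\mathbb{D}_0^\infty)$ the Banach space of bounded holomorphic (complex Fréchet differentiable) functions on $\mathbb{D}_0^\infty$ with the supremum norm. The monomial coefficients of $g\in H_\infty(\mathbb{D}_0^\infty)$ are the unique family $(c_\alpha(g))_{\alpha\in\mathbb{N}_0^{(\mathbb{N})}}$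 with $g(z)=\sum_\alpha c_\alpha(g)z^\alpha$ for all finitely supported $z\in\mathbb{D}_0^\infty$. Let $\mathcal{P}(^k c_0)$ be the space of bounded $k$-homogeneous polynomials on $c_0$, that is, the restrictions to the diagonal of bounded $k$-linear forms on $c_0$, regarded as a subspace of $H_\infty(\mathbb{D}_0^\infty)$ by restriction to $\mathbb{D}_0^\infty$. For $P\in\mathcal{P}(^k c_0)$ with associated symmetric $k$-linear form $A$, the Aron–Berner extension $AB(P):\ell_\infty\to\mathbb{C}$ is $AB(P)(z)=\tilde A(z,\dots,z)$, where $\tilde A$ is the Arens extension of $A$: the unique bounded $k$-linear extension of $A$ to $\ell_\infty=c_0^{**}$ such that $y\mapsto\tilde A(x_1,\dots,x_{j-1},y,z_{j+1},\dots,z_k)$ is weak$^*$-continuous for all $j$, all $x_i\in c_0$ and all $z_i\in\ell_\infty$. **Proposition.** There exists a unique surjective isometry $\phi:H_\infty(\mathbb{T}^\infty)\to H_\infty(\mathbb{D}_0^\infty)$ such that $c_\alpha(\phi(f))=\hat f(\alpha)$ for every $f\in H_\infty(\mathbb{T}^\infty)$ and every $\alpha\in\mathbb{N}_0^{(\mathbb{N})}$;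 it is linear, and it is the only mapping, isometric or not, with these coefficients. Moreover, for every $k\in\mathbb{N}_0$, the formula $\psi(P)(w)=AB(P)(w)$ for almost every $w\in\mathbb{T}^\infty$ defines a linear bijection $\psi:\mathcal{P}(^k c_0)\to H_\infty^k(\mathbb{T}^\infty)$, and the restriction of $\phi$ to $H_\infty^k(\mathbb{T}^\infty)$ and $\psi$ are inverse to each other: $\phi(\psi(P))=P$ on $\mathbb{D}_0^\infty$ for all $P\in\mathcal{P}(^k c_0)$, and $\phi(f)=\psi^{-1}(f)$ on $\mathbb{D}_0^\infty$ for all $f\in H_\infty^k(\mathbb{T}^\infty)$. -/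

import Mathlib

open MeasureTheory Set Filter
open scoped ENNReal Topology BoundedContinuousFunction ZeroAtInfty

namespace PolyHardy

noncomputable section

/-! ### The infinite polytorus, Fourier coefficients and Hardy spaces -/

instance instMeasurableSpaceCircle : MeasurableSpace Circle := borel Circle

instance instBorelSpaceCircle : BorelSpace Circle := ⟨rfl⟩

/-- The normalized Lebesgue measure on the unit circle `𝕋`: the image of the normalized measure
on `ℝ / ℤ` under `θ ↦ e^{2πiθ}`. -/
def circleMeasure : Measure Circle :=
  (AddCircle.haarAddCircle (T := (1 : ℝ))).map AddCircle.toCircle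

instance instIsProbabilityMeasureCircleMeasure : IsProbabilityMeasure circleMeasure :=
  Measure.isProbabilityMeasure_map AddCircle.continuous_toCircle.measurable.aemeasurable

/-- The infinite polytorus `𝕋^∞`. -/
abbrev Torus : Type := ℕ → Circle

/-- The product `m` of the normalized Lebesgue measures on `𝕋^∞`. -/
def torusMeasure : Measure Torus := Measure.infinitePi fun _ => circleMeasure

instance instIsProbabilityMeasureTorusMeasure : IsProbabilityMeasure torusMeasure := by
  unfold torusMeasure; infer_instance

/-- The monomial `w ^ α` on `𝕋^∞` for a finitely supported multi-index of integers. -/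
def torusMonomial (α : ℕ →₀ ℤ) (w : Torus) : ℂ := α.prod fun i a => ((w i : Circle) : ℂ) ^ a

theorem measurable_torusMonomial (α : ℕ →₀ ℤ) : Measurable (torusMonomial α) := by
  unfold torusMonomial Finsupp.prod
  refine Finset.measurable_prod _ fun i _ => ?_
  have h : Continuous fun c : Circle => (c : ℂ) ^ (α i) :=
    Continuous.zpow₀ (f := fun c : Circle => (c : ℂ)) continuous_subtype_val (α i)
      fun c => Or.inl (Circle.coe_ne_zero c)
  exact h.measurable.comp (measurable_pi_apply i)

theorem norm_torusMonomial (α : ℕ →₀ ℤ) (w : Torus) : ‖torusMonomial α w‖ = 1 := by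
  simp [torusMonomial, Finsupp.prod, norm_prod, norm_zpow, Circle.norm_coe]

/-- The space `L_∞(𝕋^∞)`. -/
abbrev LInfTorus : Type := Lp ℂ ∞ torusMeasure

/-- The Fourier coefficient `f̂(α) = ∫ f(w) w^{-α} dm(w)`. -/
def fourierCoeff (f : LInfTorus) (α : ℕ →₀ ℤ) : ℂ :=
  ∫ w, f w * torusMonomial (-α) w ∂torusMeasure

theorem integrable_mul_torusMonomial (f : LInfTorus) (α : ℕ →₀ ℤ) :
    Integrable (fun w => f w * torusMonomial α w) torusMeasure :=
  ((Lp.memLp f).integrable le_top).mul_bdd (c := 1)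
    (measurable_torusMonomial α).aestronglyMeasurable
    (Eventually.of_forall fun w => (norm_torusMonomial α w).le)

theorem fourierCoeff_zero (α : ℕ →₀ ℤ) : fourierCoeff 0 α = 0 := by
  rw [fourierCoeff, integral_congr_ae (g := fun _ => (0 : ℂ))]
  · simp
  · filter_upwards [Lp.coeFn_zero ℂ ∞ torusMeasure] with w hw
    rw [hw, Pi.zero_apply, zero_mul]

theorem fourierCoeff_add (f g : LInfTorus) (α : ℕ →₀ ℤ) :
    fourierCoeff (f + g) α = fourierCoeff f α + fourierCoeff g α := by
  rw [fourierCoeff, fourierCoeff, fourierCoeff,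
    ← integral_add (integrable_mul_torusMonomial f _) (integrable_mul_torusMonomial g _)]
  refine integral_congr_ae ?_
  filter_upwards [Lp.coeFn_add f g] with w hw
  rw [hw, Pi.add_apply, add_mul]

theorem fourierCoeff_smul (c : ℂ) (f : LInfTorus) (α : ℕ →₀ ℤ) :
    fourierCoeff (c • f) α = c * fourierCoeff f α := by
  rw [fourierCoeff, fourierCoeff, ← integral_const_mul]
  refine integral_congr_ae ?_
  filter_upwards [Lp.coeFn_smul c f] with w hw
  rw [hw, Pi.smul_apply, smul_eq_mul, mul_assoc]

/-- The Hardy space `H_∞(𝕋^∞)`: all `f ∈ L_∞(𝕋^∞)` with `f̂(α) = 0` for every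
`α ∈ ℤ^(ℕ) \ ℕ₀^(ℕ)`; it carries the norm of `L_∞(𝕋^∞)`. -/
def HInfTorus : Submodule ℂ LInfTorus where
  carrier := {f | ∀ α : ℕ →₀ ℤ, (¬ ∀ i, 0 ≤ α i) → fourierCoeff f α = 0}
  zero_mem' := fun α _ => fourierCoeff_zero α
  add_mem' := fun {f g} hf hg α hα => by rw [fourierCoeff_add, hf α hα, hg α hα, add_zero]
  smul_mem' := fun c f hf α hα => by rw [fourierCoeff_smul, hf α hα, mul_zero]

/-- The inclusion `ℕ₀^(ℕ) ⊆ ℤ^(ℕ)` of multi-indices. -/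
def toIntIndex (α : ℕ →₀ ℕ) : ℕ →₀ ℤ := α.mapRange (fun a : ℕ => (a : ℤ)) rfl

/-- The Fourier coefficients `f̂(α)`, `α ∈ ℕ₀^(ℕ)`, of `f ∈ H_∞(𝕋^∞)`. -/
def hardyCoeff (f : HInfTorus) (α : ℕ →₀ ℕ) : ℂ := fourierCoeff (f : LInfTorus) (toIntIndex α)

/-- The `m`-homogeneous part `H_∞^m(𝕋^∞)`: all `f ∈ H_∞(𝕋^∞)` such that `f̂(α) ≠ 0` only if
`|α| = m`. -/
def HInfTorusHom (m : ℕ) : Submodule ℂ HInfTorus where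
  carrier := {f | ∀ α : ℕ →₀ ℕ, hardyCoeff f α ≠ 0 → α.degree = m}
  zero_mem' := fun α hα => (hα (fourierCoeff_zero _)).elim
  add_mem' := fun {f g} hf hg α hα => by
    by_contra hm
    have h1 : hardyCoeff f α = 0 := by_contra fun h => hm (hf α h)
    have h2 : hardyCoeff g α = 0 := by_contra fun h => hm (hg α h)
    refine hα ?_
    have h3 : hardyCoeff (f + g) α = hardyCoeff f α + hardyCoeff g α := fourierCoeff_add _ _ _
    rw [h3, h1, h2, add_zero]
  smul_mem' := fun c f hf α hα => by
    refine hf α fun h => hα ?_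
    have h3 : hardyCoeff (c • f) α = c * hardyCoeff f α := fourierCoeff_smul _ _ _
    rw [h3, h, mul_zero]

/-! ### Bounded holomorphic functions on the open unit ball of `c₀` -/

/-- The Banach space `c₀` of complex null sequences with the supremum norm. -/
abbrev CZero : Type := C₀(ℕ, ℂ)

/-- `𝔻₀^∞`, the open unit ball of `c₀`. -/
abbrev CZeroBall : Type := Metric.ball (0 : CZero) 1

/-- A function on `𝔻₀^∞` is holomorphic if it is complex Fréchet differentiable at each point. -/
def IsHolomorphic (g : CZeroBall → ℂ) : Prop :=
  ∃ G : CZero → ℂ, DifferentiableOn ℂ G (Metric.ball 0 1) ∧ ∀ x : CZeroBall, G x = g x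

/-- The Banach space `H_∞(𝔻₀^∞)` of all bounded holomorphic functions on `𝔻₀^∞` (they are
continuous) with the supremum norm. -/
def HInfBall : Submodule ℂ (CZeroBall →ᵇ ℂ) where
  carrier := {g | IsHolomorphic g}
  zero_mem' := ⟨0, differentiableOn_const (0 : ℂ), fun _ => rfl⟩
  add_mem' := fun {g h} hg hh => by
    obtain ⟨G, hG, hGg⟩ := hg
    obtain ⟨H, hH, hHh⟩ := hh
    exact ⟨G + H, hG.add hH, fun x => by simp [hGg, hHh]⟩
  smul_mem' := fun c g hg => by
    obtain ⟨G, hG, hGg⟩ := hg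
    exact ⟨c • G, hG.const_smul c, fun x => by simp [hGg]⟩

/-- The family `c` is the family `(c_α(g))` of monomial coefficients of `g`: for all `k` and all
`z ∈ 𝔻^k`, identified with `𝔻^k × {0}`, the function `g` is given at `z` by the monomial series
expansion `g(z) = ∑_α c_α z^α`. -/
def IsMonomialCoeff (g : HInfBall) (c : (ℕ →₀ ℕ) → ℂ) : Prop :=
  ∀ (k : ℕ) (z : CZeroBall), (∀ i, k ≤ i → (z : CZero) i = 0) →
    HasSum (fun α : ℕ →₀ ℕ => c α * α.prod fun i a => (z : CZero) i ^ a)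
      ((g : CZeroBall →ᵇ ℂ) z)

/-! ### Homogeneous polynomials on `c₀` -/

/-- The bounded `m`-homogeneous polynomials `𝒫(^m c₀)`: the restrictions of bounded `m`-linear
forms to the diagonal. -/
def HomPoly (m : ℕ) : Submodule ℂ (CZero → ℂ) where
  carrier := {P | ∃ A : ContinuousMultilinearMap ℂ (fun _ : Fin m => CZero) ℂ,
    ∀ x, P x = A fun _ => x}
  zero_mem' := ⟨0, fun _ => rfl⟩
  add_mem' := fun {P Q} hP hQ => by
    obtain ⟨A, hA⟩ := hP
    obtain ⟨B, hB⟩ := hQ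
    exact ⟨A + B, fun x => by simp [hA, hB]⟩
  smul_mem' := fun c P hP => by
    obtain ⟨A, hA⟩ := hP
    exact ⟨c • A, fun x => by simp [hA]⟩

theorem HomPoly.differentiable {m : ℕ} (P : HomPoly m) :
    Differentiable ℂ (P : CZero → ℂ) := by
  obtain ⟨P, A, hA⟩ := P
  have h : P = fun x => A fun _ => x := funext hA
  subst h
  have h1 : Differentiable ℂ fun x : CZero => (fun _ : Fin m => x) :=
    differentiable_pi.2 fun _ => differentiable_id
  exact fun x => (A.hasFDerivAt _).differentiableAt.comp x (h1 x)

theorem HomPoly.exists_bound {m : ℕ} (P : HomPoly m) :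
    ∃ C : ℝ, ∀ x : CZeroBall, ‖(P : CZero → ℂ) x‖ ≤ C := by
  obtain ⟨P, A, hA⟩ := P
  refine ⟨‖A‖, fun x => ?_⟩
  change ‖P x‖ ≤ _
  rw [hA]
  refine (A.le_opNorm _).trans ?_
  have hx : ‖(x : CZero)‖ ≤ 1 := (mem_ball_zero_iff.1 x.2).le
  refine mul_le_of_le_one_right (norm_nonneg _) ?_
  simpa using pow_le_one₀ (norm_nonneg _) hx

/-- The restriction of `P ∈ 𝒫(^m c₀)` to `𝔻₀^∞`, an element of `H_∞(𝔻₀^∞)`. -/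
def HomPoly.toHInfBall {m : ℕ} (P : HomPoly m) : HInfBall :=
  ⟨BoundedContinuousFunction.ofNormedAddCommGroup (fun x : CZeroBall => (P : CZero → ℂ) x)
      ((HomPoly.differentiable P).continuous.comp continuous_subtype_val) (HomPoly.exists_bound P).choose
      (HomPoly.exists_bound P).choose_spec,
    ⟨P, (HomPoly.differentiable P).differentiableOn, fun _ => rfl⟩⟩

/-! ### The Aron–Berner extension from `c₀` to its bidual `ℓ_∞` -/

/-- The Banach space `ℓ_∞` of bounded complex sequences, the bidual of `c₀`. -/
abbrev EllInf : Type := lp (fun _ : ℕ => ℂ) ∞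

/-- The Banach space `ℓ₁` of summable complex sequences, the dual of `c₀`. -/
abbrev EllOne : Type := lp (fun _ : ℕ => ℂ) 1

/-- The canonical inclusion `c₀ ⊆ ℓ_∞`. -/
def CZero.toEllInf (x : CZero) : EllInf :=
  ⟨fun n => x n, memℓp_infty ⟨‖x‖, by
    rintro _ ⟨n, rfl⟩
    exact x.toBCF.norm_coe_le_norm n⟩⟩

/-- The inclusion `𝕋^∞ ⊆ ℓ_∞`. -/
def Torus.toEllInf (w : Torus) : EllInf :=
  ⟨fun n => (w n : ℂ), memℓp_infty ⟨1, by
    rintro _ ⟨n, rfl⟩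
    exact (Circle.norm_coe (w n)).le⟩⟩

/-- The weak* topology `σ(ℓ_∞, ℓ₁)` on `ℓ_∞`, i.e. the topology of pointwise convergence on `ℓ₁`
under the pairing `⟨z, a⟩ = ∑ z_n a_n`. -/
@[reducible] def weakStarTopology : TopologicalSpace EllInf :=
  TopologicalSpace.induced (fun (z : EllInf) (a : EllOne) => ∑' n, z n * a n) inferInstance

/-- `B` is the Arens extension of the bounded `m`-linear form `A` on `c₀` to `ℓ_∞`: it extends `A`,
and for all `j`, all `x_1, …, x_{j-1} ∈ c₀` and all `z_{j+1}, …, z_m ∈ ℓ_∞` the mapping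
`y ↦ B(x_1, …, x_{j-1}, y, z_{j+1}, …, z_m)` is weak*-continuous on `ℓ_∞`. -/
structure IsArensExtension {m : ℕ} (A : ContinuousMultilinearMap ℂ (fun _ : Fin m => CZero) ℂ)
    (B : ContinuousMultilinearMap ℂ (fun _ : Fin m => EllInf) ℂ) : Prop where
  extends_form : ∀ x : Fin m → CZero, B (fun i => CZero.toEllInf (x i)) = A x
  weakStar_continuous : ∀ (j : Fin m) (x : Fin m → CZero) (z : Fin m → EllInf),
    @Continuous EllInf ℂ weakStarTopology inferInstance fun y : EllInf =>
      B fun i => if i < j then CZero.toEllInf (x i) else if i = j then y else z i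

/-- `Q : ℓ_∞ → ℂ` is the Aron–Berner extension `AB(P)` of `P ∈ 𝒫(^m c₀)`: if `A` is the symmetric
`m`-linear form associated with `P` and `B` is its Arens extension, then
`Q(z) = B(z, …, z)`. -/
def IsAronBernerExtension {m : ℕ} (P : HomPoly m) (Q : EllInf → ℂ) : Prop :=
  ∃ (A : ContinuousMultilinearMap ℂ (fun _ : Fin m => CZero) ℂ)
    (B : ContinuousMultilinearMap ℂ (fun _ : Fin m => EllInf) ℂ),
    (∀ (σ : Equiv.Perm (Fin m)) (x : Fin m → CZero), A (fun i => x (σ i)) = A x) ∧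
    (∀ x : CZero, (P : CZero → ℂ) x = A fun _ => x) ∧
    IsArensExtension A B ∧
    ∀ z : EllInf, Q z = B fun _ => z

end

end PolyHardy

/-! A function on either side is determined by its coefficients: on the torus the monomials form a
Hilbert basis of L² and L_∞ lies in L², while on the ball finitely supported points are dense. So it
suffices to pass, norm-decreasingly, from each side to the other with the same coefficients. The two
passages are then mutually inverse, hence isometric, and linear because coefficients are.

Torus to ball (`exists_holomorphic_of_hardy`): for finitely supported z in the polydisc, let K be
the Szegő kernel and S = ∑ |z^α|². Since the Fourier coefficients of f at indices with a negative
entry vanish, ∫ f |K|² = S · ∑ f̂(α) z^α (`integral_mul_szego`). Taking f = 1 shows that |K|²/S is a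
probability density, so the power series is bounded by ‖f‖. Truncating to n variables gives
uniformly bounded holomorphic functions on the whole ball, and a Montel-type argument along an
ultrafilter (`exists_differentiableOn_of_norm_le`) supplies the function.

Ball to torus (`exists_hardy_of_holomorphic`): Cauchy estimates, one variable at a time, give the
monomial expansion. The functions w ↦ g(r w_0, …, r w_{n-1}, 0, …) are bounded by ‖g‖ and have
damped coefficients. Bessel's inequality puts the undamped coefficients in ℓ², dominated convergence
gives L²-convergence as n → ∞ and r → 1, and an a.e. convergent subsequence keeps the bound.

Polynomials: the Arens extension is built one variable at a time from c₀' = ℓ₁. Expanding its first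
variable in unit vectors gives a recursion for the Fourier coefficients of AB(P) on the torus. They
live on |α| = k and agree with the monomial coefficients of P, so φ⁻¹(P) is AB(P) almost everywhere.
Conversely, if the coefficients of g live on |α| = k, its truncations are polynomials, and
polarization bounds their symmetric forms uniformly. A cluster point of these forms represents g
(`exists_homPoly_of_coeff`). -/

namespace PolyHardy

/-! ### Limits of bounded families of holomorphic functions -/

section Limits

variable {E : Type*} [NormedAddCommGroup E] [NormedSpace ℂ E]

/-- A second order Taylor estimate for bounded holomorphic functions on a ball. -/
theorem norm_sub_sub_fderiv_le {f : E → ℂ} {x : E} {r M : ℝ} (hr : 0 < r)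
    (hf : DifferentiableOn ℂ f (Metric.ball x r)) (hM : ∀ y ∈ Metric.ball x r, ‖f y‖ ≤ M) :
    ‖fderiv ℂ f x‖ ≤ 2 * M / r ∧ ∀ w ∈ Metric.ball x r,
      ‖f w - f x - fderiv ℂ f x (w - x)‖ ≤ 4 * M * (‖w - x‖ / r) ^ 2 := by
  have hx : x ∈ Metric.ball x r := Metric.mem_ball_self hr
  have hmaps : MapsTo f (Metric.ball x r) (Metric.closedBall (f x) (2 * M)) := by
    intro y hy
    rw [mem_closedBall_iff_norm]
    linarith [norm_sub_le (f y) (f x), hM y hy, hM x hx]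
  have hL := Complex.norm_fderiv_le_div_of_mapsTo_ball hf hmaps hr
  refine ⟨hL, fun w hw => ?_⟩
  have hfx : DifferentiableAt ℂ f x := hf.differentiableAt (Metric.ball_mem_nhds x hr)
  -- After removal of the linear part, h - h x vanishes to first order at x, and |h - h x| ≤ 2M +
  -- 2M. The higher-order Schwarz lemma then gives the quadratic bound.
  set h : E → ℂ := fun w => f w - fderiv ℂ f x (w - x) with hh
  have hhx : h x = f x := by simp [hh]
  have hd : DifferentiableOn ℂ h (Metric.ball x r) :=
    hf.sub (by fun_prop)
  have hmaps' : MapsTo h (Metric.ball x r) (Metric.closedBall (h x) (4 * M)) := by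
    intro y hy
    rw [mem_closedBall_iff_norm, hhx]
    have h1 : ‖fderiv ℂ f x (y - x)‖ ≤ 2 * M := by
      refine (ContinuousLinearMap.le_of_opNorm_le _ hL _).trans ?_
      have h2 : ‖y - x‖ ≤ r := by
        rw [Metric.mem_ball, dist_eq_norm] at hy; exact hy.le
      have hM0 : 0 ≤ M := (norm_nonneg _).trans (hM x hx)
      calc 2 * M / r * ‖y - x‖ ≤ 2 * M / r * r := by gcongr
        _ = 2 * M := by field_simp
    have h3 : h y - f x = f y - f x - fderiv ℂ f x (y - x) := by simp only [hh]; ring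
    rw [h3]
    linarith [norm_sub_le (f y - f x) (fderiv ℂ f x (y - x)), norm_sub_le (f y) (f x), hM y hy,
      hM x hx]
  have ho : (fun w => h w - h x) =o[𝓝 x] fun w => ‖w - x‖ ^ 1 := by
    simp only [pow_one]
    refine Asymptotics.IsLittleO.norm_right ?_
    refine (hasFDerivAt_iff_isLittleO.1 hfx.hasFDerivAt).congr_left fun w => ?_
    rw [hhx]; simp only [hh]; ring
  have := Complex.dist_le_mul_div_pow_of_mapsTo_ball_of_isLittleO hd hmaps' ho hw
  rw [dist_eq_norm, dist_eq_norm, hhx] at this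
  refine le_trans (le_of_eq ?_) this
  simp only [hh]; congr 1; ring

/-- A pointwise limit of a uniformly bounded family of holomorphic functions is holomorphic. -/
theorem differentiableOn_of_tendsto_of_norm_le {ι : Type*} {l : Filter ι} [l.NeBot]
    {F : ι → E → ℂ} {G : E → ℂ} {U : Set E} {M : ℝ} (hU : IsOpen U)
    (hF : ∀ i, DifferentiableOn ℂ (F i) U) (hM : ∀ i, ∀ x ∈ U, ‖F i x‖ ≤ M)
    (hlim : ∀ x ∈ U, Tendsto (fun i => F i x) l (𝓝 (G x))) : DifferentiableOn ℂ G U := by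
  intro x hx
  obtain ⟨r, hr, hrU⟩ := Metric.isOpen_iff.1 hU x hx
  have key := fun i => norm_sub_sub_fderiv_le hr ((hF i).mono hrU) fun y hy => hM i y (hrU hy)
  -- Along an ultrafilter, bounded families of scalars converge by compactness, so the derivatives
  -- at x have a pointwise limit without any separability of E.
  set u : Ultrafilter ι := Ultrafilter.of l with hu
  have hul : (u : Filter ι) ≤ l := Ultrafilter.of_le l
  have hex : ∀ h : E, ∃ a : ℂ, Tendsto (fun i => fderiv ℂ (F i) x h) u (𝓝 a) := by
    intro h
    obtain ⟨a, -, ha⟩ := (isCompact_closedBall (0 : ℂ) (2 * M / r * ‖h‖)).ultrafilter_le_nhds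
      (u.map fun i => fderiv ℂ (F i) x h) (by
        rw [le_principal_iff]
        refine Filter.mem_map.2 (Filter.univ_mem' fun i => ?_)
        rw [mem_preimage, mem_closedBall_zero_iff]
        exact ContinuousLinearMap.le_of_opNorm_le _ (key i).1 _)
    exact ⟨a, ha⟩
  choose L hL using hex
  let L' : E →L[ℂ] ℂ := ContinuousLinearMap.ofTendstoOfBoundedRange (l := (u : Filter ι)) L
    (fun i => fderiv ℂ (F i) x) (tendsto_pi_nhds.2 hL) (by
      refine (Metric.isBounded_closedBall (x := (0 : E →L[ℂ] ℂ)) (r := 2 * M / r)).subset ?_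
      rintro _ ⟨i, rfl⟩
      exact mem_closedBall_zero_iff.2 (key i).1)
  have hL' : ∀ h, L' h = L h := fun h => rfl
  -- The Taylor remainder bound is uniform in the family and survives the limit; it identifies `L'`
  -- as the derivative of G.
  have hrem : ∀ w ∈ Metric.ball x r, ‖G w - G x - L' (w - x)‖ ≤ 4 * M * (‖w - x‖ / r) ^ 2 := by
    intro w hw
    have ht : Tendsto (fun i => F i w - F i x - fderiv ℂ (F i) x (w - x)) u
        (𝓝 (G w - G x - L' (w - x))) :=
      (((hlim w (hrU hw)).mono_left hul).sub ((hlim x hx).mono_left hul)).sub (hL _)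
    exact le_of_tendsto ht.norm (Eventually.of_forall fun i => (key i).2 w hw)
  refine DifferentiableAt.differentiableWithinAt ⟨L', ?_⟩
  have h1 : HasFDerivAt (fun w => G w - G x - L' (w - x)) (0 : E →L[ℂ] ℂ) x := by
    refine Asymptotics.IsBigO.hasFDerivAt (n := 2) ?_ one_lt_two
    refine Asymptotics.IsBigO.of_bound (4 * M / r ^ 2) ?_
    filter_upwards [Metric.ball_mem_nhds x hr] with w hw
    refine (hrem w hw).trans (le_of_eq ?_)
    simp; ring
  have h2 : HasFDerivAt (fun w => L' (w - x)) L' x :=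
    L'.hasFDerivAt.comp x ((hasFDerivAt_id x).sub_const x)
  have h3 := (h1.add h2).add_const (G x)
  refine (h3.congr_fderiv (zero_add _)).congr_of_eventuallyEq (Eventually.of_forall fun w => ?_)
  simp

/-- A uniformly bounded sequence of holomorphic functions on an open set has a holomorphic
cluster point for pointwise convergence. -/
theorem exists_differentiableOn_of_norm_le {F : ℕ → E → ℂ} {U : Set E} {M : ℝ}
    (hU : IsOpen U) (hF : ∀ n, DifferentiableOn ℂ (F n) U) (hM : ∀ n, ∀ x ∈ U, ‖F n x‖ ≤ M) :
    ∃ G : E → ℂ, DifferentiableOn ℂ G U ∧ (∀ x ∈ U, ‖G x‖ ≤ M) ∧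
      ∀ x ∈ U, ∀ a, Tendsto (fun n => F n x) atTop (𝓝 a) → G x = a := by
  set u : Ultrafilter ℕ := Ultrafilter.of atTop with hu
  have hex : ∀ x : E, ∃ a : ℂ, x ∈ U → Tendsto (fun n => F n x) u (𝓝 a) := by
    intro x
    by_cases hx : x ∈ U
    · obtain ⟨a, -, ha⟩ := (isCompact_closedBall (0 : ℂ) M).ultrafilter_le_nhds
        (u.map fun n => F n x) (by
          rw [le_principal_iff]
          refine Filter.mem_map.2 (Filter.univ_mem' fun n => ?_)
          rw [mem_preimage, mem_closedBall_zero_iff]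
          exact hM n x hx)
      exact ⟨a, fun _ => ha⟩
    · exact ⟨0, fun h => (hx h).elim⟩
  choose G hG using hex
  refine ⟨G, differentiableOn_of_tendsto_of_norm_le hU hF hM hG, fun x hx => ?_, fun x hx a ha => ?_⟩
  · exact le_of_tendsto (hG x hx).norm (Eventually.of_forall fun n => hM n x hx)
  · exact tendsto_nhds_unique (hG x hx) (ha.mono_left (Ultrafilter.of_le _))

end Limits

/-! ### Truncation of sequences -/

section Truncation

theorem norm_apply_le (x : CZero) (i : ℕ) : ‖x i‖ ≤ ‖x‖ := x.toBCF.norm_coe_le_norm i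

theorem CZero.norm_le {x : CZero} {C : ℝ} (hC : 0 ≤ C) (h : ∀ i, ‖x i‖ ≤ C) : ‖x‖ ≤ C :=
  (BoundedContinuousFunction.norm_le (f := x.toBCF) hC).2 h

/-- The truncation of a sequence to its first `n` entries, as an element of `c₀`. -/
noncomputable def cut (n : ℕ) : (ℕ → ℂ) →ₗ[ℂ] CZero where
  toFun u :=
    { toFun := fun i => if i < n then u i else 0
      continuous_toFun := continuous_of_discreteTopology
      zero_at_infty' := by
        rw [cocompact_eq_atTop]
        refine tendsto_const_nhds.congr' ?_
        filter_upwards [eventually_ge_atTop n] with i hi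
        rw [if_neg (not_lt.2 hi)] }
  map_add' u v := by
    ext i
    change (if i < n then (u + v) i else 0) = (if i < n then u i else 0) + if i < n then v i else 0
    split_ifs <;> simp
  map_smul' c u := by
    ext i
    change (if i < n then (c • u) i else 0) = c • (if i < n then u i else 0)
    split_ifs <;> simp

theorem cut_apply (n : ℕ) (u : ℕ → ℂ) (i : ℕ) : cut n u i = if i < n then u i else 0 := rfl

theorem norm_cut_le {n : ℕ} {u : ℕ → ℂ} {C : ℝ} (hC : 0 ≤ C) (h : ∀ i < n, ‖u i‖ ≤ C) :
    ‖cut n u‖ ≤ C := by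
  refine CZero.norm_le hC fun i => ?_
  rw [cut_apply]
  split_ifs with hi
  · exact h i hi
  · simpa using hC

theorem norm_cut_coe_le (n : ℕ) (x : CZero) : ‖cut n x‖ ≤ ‖x‖ :=
  norm_cut_le (norm_nonneg x) fun i _ => norm_apply_le x i

theorem cut_eq_self {n : ℕ} {x : CZero} (h : ∀ i, n ≤ i → x i = 0) : cut n x = x := by
  ext i
  rw [cut_apply]
  split_ifs with hi
  · rfl
  · exact (h i (not_lt.1 hi)).symm

/-- This is where being a null sequence enters: the error is the supremum of a tail. It makes
finitely supported points dense. -/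
theorem tendsto_cut (x : CZero) : Tendsto (fun n => cut n x) atTop (𝓝 x) := by
  rw [Metric.tendsto_atTop]
  intro ε hε
  have hx : Tendsto (fun i => x i) atTop (𝓝 0) := by
    have := x.zero_at_infty'
    rwa [cocompact_eq_atTop] at this
  obtain ⟨N, hN⟩ := Metric.tendsto_atTop.1 hx (ε / 2) (by positivity)
  refine ⟨N, fun n hn => ?_⟩
  rw [dist_eq_norm]
  refine lt_of_le_of_lt (CZero.norm_le (by positivity) fun i => ?_) (half_lt_self hε)
  change ‖cut n x i - x i‖ ≤ _
  rw [cut_apply]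
  split_ifs with hi
  · simp; positivity
  · have := (hN i (hn.trans (not_lt.1 hi))).le
    simpa using this

/-- Truncation as a bounded operator on `c₀`. -/
noncomputable def trunc (n : ℕ) : CZero →L[ℂ] CZero :=
  LinearMap.mkContinuous
    { toFun := fun x => cut n x
      map_add' := fun x y => (cut n).map_add x y
      map_smul' := fun c x => (cut n).map_smul c x } 1
    fun x => by simpa using norm_cut_coe_le n x

/-- The unit vectors of `c₀`. -/
noncomputable def unitVec (i : ℕ) : CZero := cut (i + 1) (Pi.single i 1)

theorem unitVec_apply (i j : ℕ) : unitVec i j = if j = i then 1 else 0 := by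
  rw [unitVec, cut_apply, Pi.single_apply]
  split_ifs <;> first | rfl | omega

theorem cut_eq_sum (n : ℕ) (u : ℕ → ℂ) : cut n u = ∑ i ∈ Finset.range n, u i • unitVec i := by
  induction n with
  | zero => ext i; simp [cut_apply]
  | succ n ih =>
    rw [Finset.sum_range_succ, ← ih]
    ext i
    change _ = cut n u i + u n * unitVec n i
    simp only [cut_apply, unitVec_apply]
    split_ifs <;> first | omega | simp_all

/-- The coordinate functionals on `c₀`. -/
noncomputable def coord (i : ℕ) : CZero →L[ℂ] ℂ :=
  LinearMap.mkContinuous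
    { toFun := fun x => x i
      map_add' := fun _ _ => rfl
      map_smul' := fun _ _ => rfl } 1
    fun x => by simpa using norm_apply_le x i

/-- The truncation of a point of the unit ball. -/
noncomputable def cutBall (n : ℕ) (z : CZeroBall) : CZeroBall :=
  ⟨cut n (z : CZero), mem_ball_zero_iff.2
    ((norm_cut_coe_le n _).trans_lt (mem_ball_zero_iff.1 z.2))⟩

theorem tendsto_cutBall (z : CZeroBall) : Tendsto (fun n => cutBall n z) atTop (𝓝 z) :=
  tendsto_subtype_rng.2 (tendsto_cut (z : CZero))

/-- A bounded holomorphic function is determined by its monomial coefficients. -/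
theorem IsMonomialCoeff.eq {g h : HInfBall} {c : (ℕ →₀ ℕ) → ℂ} (hg : IsMonomialCoeff g c)
    (hh : IsMonomialCoeff h c) : g = h := by
  have key : ∀ n z, (g : CZeroBall →ᵇ ℂ) (cutBall n z) = (h : CZeroBall →ᵇ ℂ) (cutBall n z) := by
    intro n z
    have hz : ∀ i, n ≤ i → (cutBall n z : CZero) i = 0 := fun i hi => by
      change cut n (z : CZero) i = 0
      rw [cut_apply, if_neg (not_lt.2 hi)]
    exact (hg n _ hz).unique (hh n _ hz)
  refine Subtype.ext (BoundedContinuousFunction.ext fun z => ?_)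
  have h1 := ((g : CZeroBall →ᵇ ℂ).continuous.tendsto z).comp (tendsto_cutBall z)
  have h2 := ((h : CZeroBall →ᵇ ℂ).continuous.tendsto z).comp (tendsto_cutBall z)
  exact tendsto_nhds_unique h1 (h2.congr fun n => (key n z).symm)

end Truncation

/-! ### Monomials and their absolute summability -/

section Monomials

/-- The monomial `u ^ α`. -/
noncomputable def mono (u : ℕ → ℂ) (α : ℕ →₀ ℕ) : ℂ := α.prod fun i a => u i ^ a

theorem mono_add (u : ℕ → ℂ) (α β : ℕ →₀ ℕ) : mono u (α + β) = mono u α * mono u β :=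
  Finsupp.prod_add_index' (fun _ => pow_zero _) fun _ _ _ => pow_add _ _ _

theorem mono_zero (u : ℕ → ℂ) : mono u 0 = 1 := Finsupp.prod_zero_index

theorem mono_single (u : ℕ → ℂ) (i k : ℕ) : mono u (Finsupp.single i k) = u i ^ k :=
  Finsupp.prod_single_index (pow_zero _)

theorem norm_mono (u : ℕ → ℂ) (α : ℕ →₀ ℕ) : ‖mono u α‖ = α.prod fun i a => ‖u i‖ ^ a := by
  simp [mono, Finsupp.prod, norm_prod]

theorem mono_mul (u v : ℕ → ℂ) (α : ℕ →₀ ℕ) : mono (fun i => u i * v i) α = mono u α * mono v α := by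
  simp [mono, Finsupp.prod, mul_pow, Finset.prod_mul_distrib]

theorem mono_const (r : ℂ) (α : ℕ →₀ ℕ) : mono (fun _ => r) α = r ^ α.degree := by
  simp [mono, Finsupp.prod, Finset.prod_pow_eq_pow_sum, Finsupp.degree_apply]

theorem mono_congr {u v : ℕ → ℂ} {α : ℕ →₀ ℕ} (h : ∀ i, α i ≠ 0 → u i = v i) :
    mono u α = mono v α :=
  Finsupp.prod_congr fun i hi => by rw [h i (Finsupp.mem_support_iff.1 hi)]

theorem mono_eq_zero {u : ℕ → ℂ} {α : ℕ →₀ ℕ} {i : ℕ} (hi : α i ≠ 0) (hu : u i = 0) :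
    mono u α = 0 :=
  Finset.prod_eq_zero (Finsupp.mem_support_iff.2 hi) (by simp [hu, hi])

open Classical in
theorem mono_cut (n : ℕ) (u : ℕ → ℂ) (α : ℕ →₀ ℕ) :
    mono (cut n u) α = if ∀ i, n ≤ i → α i = 0 then mono u α else 0 := by
  split_ifs with h
  · refine mono_congr fun i hi => ?_
    rw [cut_apply, if_pos]
    by_contra hn
    exact hi (h i (not_lt.1 hn))
  · push Not at h
    obtain ⟨i, hi, hα⟩ := h
    exact mono_eq_zero hα (by rw [cut_apply, if_neg (not_lt.2 hi)])

/-- For a finitely supported point `u` of the polydisc, `∑ |u ^ α| < ∞`. -/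
theorem summable_norm_mono {n : ℕ} {u : ℕ → ℂ} (h1 : ∀ i, ‖u i‖ < 1) (h0 : ∀ i, n ≤ i → u i = 0) :
    Summable fun α : ℕ →₀ ℕ => ‖mono u α‖ := by
  -- The bound is the product of the n geometric series. Up to vanishing terms, every finite set of
  -- multi-indices lies in a box of exponents below N in the first n variables, and over the box the
  -- sum factors.
  refine summable_of_sum_le (c := ∏ i ∈ Finset.range n, (1 - ‖u i‖)⁻¹) (fun _ => norm_nonneg _)
    fun S => ?_
  classical
  obtain ⟨N, hN⟩ : ∃ N : ℕ, ∀ α ∈ S, ∀ i, α i < N := by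
    refine ⟨S.sup (fun α => α.degree) + 1, fun α hα i => ?_⟩
    exact Nat.lt_succ_of_le ((Finsupp.le_degree i α).trans
      (Finset.le_sup (f := fun α : ℕ →₀ ℕ => α.degree) hα))
  set T : Finset (ℕ →₀ ℕ) := (Finset.range n).finsupp fun _ => Finset.range N with hT
  have hsub : ∑ α ∈ S, ‖mono u α‖ ≤ ∑ α ∈ T, ‖mono u α‖ := by
    rw [← Finset.sum_filter_add_sum_filter_not S (fun α => α ∈ T)]
    have hz : ∑ α ∈ S with ¬ α ∈ T, ‖mono u α‖ = 0 := by
      refine Finset.sum_eq_zero fun α hα => ?_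
      rw [Finset.mem_filter, hT, Finset.mem_finsupp_iff] at hα
      obtain ⟨hαS, hα⟩ := hα
      have : ∃ i, n ≤ i ∧ α i ≠ 0 := by
        by_contra hcon
        push Not at hcon
        refine hα ⟨fun i hi => ?_, fun i _ => Finset.mem_range.2 (hN α hαS i)⟩
        rw [Finset.mem_range]
        by_contra hin
        exact Finsupp.mem_support_iff.1 (by simpa using hi) (hcon i (not_lt.1 hin))
      obtain ⟨i, hi, hαi⟩ := this
      rw [mono_eq_zero hαi (h0 i hi), norm_zero]
    rw [hz, add_zero]
    exact Finset.sum_le_sum_of_subset_of_nonneg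
      (fun α hα => (Finset.mem_filter.1 hα).2) fun _ _ _ => norm_nonneg _
  refine hsub.trans ?_
  have hsum : ∑ α ∈ T, ‖mono u α‖ = ∏ i ∈ Finset.range n, ∑ k ∈ Finset.range N, ‖u i‖ ^ k := by
    rw [Finset.prod_sum, hT, Finset.finsupp, Finset.sum_map]
    refine Finset.sum_congr (by congr!) fun p hp => ?_
    rw [norm_mono]
    change (Finsupp.indicator (Finset.range n) p).prod (fun i a => ‖u i‖ ^ a) = _
    rw [Finsupp.prod_of_support_subset (s := Finset.range n) _
      (Finsupp.support_indicator_subset _ _) _ fun i _ => pow_zero _, ← Finset.prod_attach]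
    refine Finset.prod_congr rfl fun i _ => ?_
    change ‖u i‖ ^ (Finsupp.indicator (Finset.range n) p i) = _
    rw [Finsupp.indicator_of_mem i.2]
  rw [hsum]
  refine Finset.prod_le_prod (fun i _ => Finset.sum_nonneg fun k _ => by positivity) fun i _ => ?_
  rw [← tsum_geometric_of_lt_one (norm_nonneg _) (h1 i)]
  exact (summable_geometric_of_lt_one (norm_nonneg _) (h1 i)).sum_le_tsum _
    fun k _ => by positivity

end Monomials

/-! ### Fourier analysis on the infinite polytorus -/

section Fourier

theorem torusMonomial_zero (w : Torus) : torusMonomial 0 w = 1 := Finsupp.prod_zero_index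

theorem torusMonomial_add (α β : ℕ →₀ ℤ) (w : Torus) :
    torusMonomial (α + β) w = torusMonomial α w * torusMonomial β w :=
  Finsupp.prod_add_index' (fun _ => zpow_zero _) fun _ _ _ => zpow_add₀ (Circle.coe_ne_zero _) _ _

theorem torusMonomial_neg (α : ℕ →₀ ℤ) (w : Torus) :
    torusMonomial (-α) w = (starRingEnd ℂ) (torusMonomial α w) := by
  have h : torusMonomial (-α) w * torusMonomial α w = 1 := by
    rw [← torusMonomial_add, neg_add_cancel, torusMonomial_zero]
  rw [eq_inv_of_mul_eq_one_left h, Complex.inv_def, Complex.normSq_eq_norm_sq, norm_torusMonomial]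
  simp

theorem torusMonomial_single (i : ℕ) (k : ℤ) (w : Torus) :
    torusMonomial (Finsupp.single i k) w = (w i : ℂ) ^ k :=
  Finsupp.prod_single_index (zpow_zero _)

theorem torusMonomial_toIntIndex (α : ℕ →₀ ℕ) (w : Torus) :
    torusMonomial (toIntIndex α) w = mono (fun i => (w i : ℂ)) α := by
  rw [torusMonomial, toIntIndex, Finsupp.prod_mapRange_index fun _ => zpow_zero _]
  simp [mono]

theorem torusMonomial_mul_left (α : ℕ →₀ ℤ) (u w : Torus) :
    torusMonomial α (u * w) = torusMonomial α u * torusMonomial α w := by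
  simp [torusMonomial, Finsupp.prod, mul_zpow, Finset.prod_mul_distrib]

theorem continuous_torusMonomial (α : ℕ →₀ ℤ) : Continuous (torusMonomial α) := by
  unfold torusMonomial Finsupp.prod
  refine continuous_finsetProd _ fun i _ => ?_
  exact (continuous_subtype_val.comp (continuous_apply i)).zpow₀ _
    fun w => Or.inl (Circle.coe_ne_zero (w i))

/-- Written as the image of an angle, a rotation becomes a translation of ℝ/ℤ, which preserves Haar
measure. -/
theorem circleMeasure_map_mul (u : Circle) : circleMeasure.map (fun c => u * c) = circleMeasure := by
  obtain ⟨a, rfl⟩ : ∃ a : AddCircle (1 : ℝ), AddCircle.toCircle a = u := by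
    obtain ⟨a, ha⟩ := (AddCircle.homeomorphCircle (one_ne_zero (α := ℝ))).surjective u
    exact ⟨a, by rwa [AddCircle.homeomorphCircle_apply] at ha⟩
  have hm : Measurable (AddCircle.toCircle (T := (1 : ℝ))) :=
    AddCircle.continuous_toCircle.measurable
  have hc : Measurable fun c : Circle => AddCircle.toCircle a * c :=
    (continuous_const_mul (AddCircle.toCircle a)).measurable
  rw [circleMeasure, Measure.map_map hc hm]
  have : (fun c => AddCircle.toCircle a * c) ∘ AddCircle.toCircle (T := (1 : ℝ)) =
      AddCircle.toCircle ∘ fun x => a + x := by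
    funext x; simp [AddCircle.toCircle_add]
  rw [this, ← Measure.map_map hm (measurable_const_add a), map_add_left_eq_self]

theorem torusMeasure_map_mul (u : Torus) : torusMeasure.map (fun w => u * w) = torusMeasure := by
  have h := Measure.infinitePi_map_pi (fun _ : ℕ => circleMeasure)
    (f := fun i c => u i * c) fun i => (continuous_const_mul (u i)).measurable
  simp only [circleMeasure_map_mul] at h
  exact h

/-- If α j ≠ 0, rotating the j-th coordinate by exp(iπ/α j) changes the sign of the monomial but not
the measure, so the integral equals its own negative. -/
theorem integral_torusMonomial (α : ℕ →₀ ℤ) :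
    ∫ w, torusMonomial α w ∂torusMeasure = if α = 0 then 1 else 0 := by
  split_ifs with h
  · subst h; simp [torusMonomial_zero]
  obtain ⟨j, hj⟩ : ∃ j, α j ≠ 0 := by
    by_contra hcon
    push Not at hcon
    exact h (Finsupp.ext hcon)
  set v : Circle := Circle.exp (Real.pi / α j) with hv
  have hvj : ((v : Circle) : ℂ) ^ α j = -1 := by
    rw [hv, ← Circle.coe_zpow, ← Circle.exp_zsmul, Circle.coe_exp]
    have : ((α j • (Real.pi / (α j : ℝ)) : ℝ) : ℂ) = Real.pi := by
      rw [zsmul_eq_mul, mul_div_cancel₀ _ (by exact_mod_cast hj)]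
    rw [this, Complex.exp_pi_mul_I]
  set u : Torus := Function.update 1 j v with hu
  have hmono : torusMonomial α u = -1 := by
    rw [torusMonomial, Finsupp.prod, Finset.prod_eq_single j]
    · simpa [hu] using hvj
    · intro b _ hb; simp [hu, Function.update_of_ne hb]
    · intro hb; exact (hb (Finsupp.mem_support_iff.2 hj)).elim
  have h1 : ∫ w, torusMonomial α w ∂torusMeasure = -∫ w, torusMonomial α w ∂torusMeasure := by
    conv_lhs => rw [← torusMeasure_map_mul u]
    rw [integral_map (by fun_prop) (continuous_torusMonomial α).aestronglyMeasurable,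
      ← integral_neg]
    refine integral_congr_ae (Eventually.of_forall fun w => ?_)
    simp only [torusMonomial_mul_left, hmono]; ring
  exact self_eq_neg.1 h1

/-- The monomial `w ^ α` as a continuous function on `𝕋^∞`. -/
noncomputable def torusMonomialC (α : ℕ →₀ ℤ) : C(Torus, ℂ) :=
  ⟨torusMonomial α, continuous_torusMonomial α⟩

/-- The star subalgebra generated by the monomials. -/
noncomputable def trigSubalgebra : StarSubalgebra ℂ C(Torus, ℂ) where
  toSubalgebra := Algebra.adjoin ℂ (range torusMonomialC)
  star_mem' := by
    change Algebra.adjoin ℂ (range torusMonomialC) ≤ star (Algebra.adjoin ℂ (range torusMonomialC))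
    refine Algebra.adjoin_le ?_
    rintro - ⟨α, rfl⟩
    exact Algebra.subset_adjoin ⟨-α, ContinuousMap.ext fun w => torusMonomial_neg α w⟩

/-- Monomials are closed under multiplication, so the algebra they generate is already their linear
span. -/
theorem trigSubalgebra_coe :
    Subalgebra.toSubmodule trigSubalgebra.toSubalgebra = Submodule.span ℂ (range torusMonomialC) := by
  apply Algebra.adjoin_eq_span_of_subset
  refine Subset.trans ?_ Submodule.subset_span
  intro x hx
  refine Submonoid.closure_induction (fun _ => id) ⟨0, ?_⟩ ?_ hx
  · ext1 w; exact torusMonomial_zero w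
  · rintro - - - - ⟨α, rfl⟩ ⟨β, rfl⟩
    exact ⟨α + β, ContinuousMap.ext fun w => torusMonomial_add α β w⟩

theorem trigSubalgebra_separatesPoints : trigSubalgebra.SeparatesPoints := by
  intro x y hxy
  obtain ⟨i, hi⟩ := Function.ne_iff.1 hxy
  refine ⟨_, ⟨torusMonomialC (Finsupp.single i 1), Algebra.subset_adjoin ⟨_, rfl⟩, rfl⟩, ?_⟩
  change torusMonomial _ x ≠ torusMonomial _ y
  rw [torusMonomial_single, torusMonomial_single, zpow_one, zpow_one]
  exact fun h => hi (Circle.ext h)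

/-- Stone–Weierstrass on the compact torus; the algebra is stable under conjugation because
conjugating w^α gives w^{-α}. -/
theorem span_torusMonomialC_closure :
    (Submodule.span ℂ (range torusMonomialC)).topologicalClosure = ⊤ := by
  rw [← trigSubalgebra_coe]
  exact congr_arg (Subalgebra.toSubmodule <| StarSubalgebra.toSubalgebra ·)
    (ContinuousMap.starSubalgebra_topologicalClosure_eq_top_of_separatesPoints trigSubalgebra
      trigSubalgebra_separatesPoints)

/-- The monomial `w ^ α` as an element of `L²(𝕋^∞)`. -/
noncomputable def torusMonomialLp (α : ℕ →₀ ℤ) : Lp ℂ 2 torusMeasure :=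
  ContinuousMap.toLp (E := ℂ) 2 torusMeasure ℂ (torusMonomialC α)

theorem coeFn_torusMonomialLp (α : ℕ →₀ ℤ) : torusMonomialLp α =ᵐ[torusMeasure] torusMonomial α :=
  ContinuousMap.coeFn_toLp torusMeasure (torusMonomialC α)

theorem inner_torusMonomialLp (α : ℕ →₀ ℤ) (f : Lp ℂ 2 torusMeasure) :
    inner ℂ (torusMonomialLp α) f = ∫ w, f w * torusMonomial (-α) w ∂torusMeasure := by
  rw [L2.inner_def]
  refine integral_congr_ae ?_
  filter_upwards [coeFn_torusMonomialLp α] with w hw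
  rw [hw, torusMonomial_neg, RCLike.inner_apply]

theorem orthonormal_torusMonomialLp : Orthonormal ℂ torusMonomialLp := by
  rw [orthonormal_iff_ite]
  intro α β
  rw [inner_torusMonomialLp]
  have : ∫ w, (torusMonomialLp β) w * torusMonomial (-α) w ∂torusMeasure =
      ∫ w, torusMonomial (β - α) w ∂torusMeasure := by
    refine integral_congr_ae ?_
    filter_upwards [coeFn_torusMonomialLp β] with w hw
    rw [hw, ← torusMonomial_add, sub_eq_add_neg]
  rw [this, integral_torusMonomial]
  simp [sub_eq_zero, eq_comm]

theorem span_torusMonomialLp_closure :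
    (Submodule.span ℂ (range torusMonomialLp)).topologicalClosure = ⊤ := by
  convert!
    (ContinuousMap.toLp_denseRange ℂ torusMeasure ℂ (p := 2)
      (by simp)).topologicalClosure_map_submodule span_torusMonomialC_closure
  rw [Submodule.map_span]
  unfold torusMonomialLp
  rw [range_comp']
  simp only [ContinuousLinearMap.coe_coe]

/-- The monomials form a Hilbert basis of `L²(𝕋^∞)`. -/
noncomputable def torusBasis : HilbertBasis (ℕ →₀ ℤ) ℂ (Lp ℂ 2 torusMeasure) :=
  HilbertBasis.mk orthonormal_torusMonomialLp span_torusMonomialLp_closure.ge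

theorem torusBasis_repr (f : Lp ℂ 2 torusMeasure) (α : ℕ →₀ ℤ) :
    torusBasis.repr f α = ∫ w, f w * torusMonomial (-α) w ∂torusMeasure := by
  rw [HilbertBasis.repr_apply_apply, ← inner_torusMonomialLp, torusBasis, HilbertBasis.coe_mk]

/-- An element of `L_∞(𝕋^∞)` is determined by its Fourier coefficients. -/
theorem LInfTorus.ext_fourierCoeff {f g : LInfTorus}
    (h : ∀ α, fourierCoeff f α = fourierCoeff g α) : f = g := by
  -- The measure is finite, so L_∞ embeds in L², where the Hilbert basis decides equality.
  have h2 : ∀ f : LInfTorus, MemLp f 2 torusMeasure := fun f =>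
    (Lp.memLp f).mono_exponent le_top
  have h3 : ∀ (f : LInfTorus) α, torusBasis.repr ((h2 f).toLp f) α = fourierCoeff f α := by
    intro f α
    rw [torusBasis_repr, fourierCoeff]
    refine integral_congr_ae ?_
    filter_upwards [(h2 f).coeFn_toLp] with w hw
    rw [hw]
  have h4 : (h2 f).toLp f = (h2 g).toLp g :=
    torusBasis.repr.injective (lp.ext (funext fun α => by rw [h3, h3, h]))
  refine Lp.ext ?_
  exact (h2 f).coeFn_toLp.symm.trans (h4 ▸ (h2 g).coeFn_toLp)

theorem toIntIndex_apply (α : ℕ →₀ ℕ) (i : ℕ) : toIntIndex α i = α i := rfl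

theorem toIntIndex_injective : Function.Injective toIntIndex :=
  Finsupp.mapRange_injective _ rfl Nat.cast_injective

theorem toIntIndex_add (α β : ℕ →₀ ℕ) : toIntIndex (α + β) = toIntIndex α + toIntIndex β := by
  ext i; simp [toIntIndex_apply]

theorem exists_toIntIndex_eq {α : ℕ →₀ ℤ} (h : ∀ i, 0 ≤ α i) : ∃ β, toIntIndex β = α :=
  ⟨α.mapRange Int.toNat rfl, by ext i; simp [toIntIndex_apply, h i]⟩

theorem HInfTorus.ext_hardyCoeff {f g : HInfTorus} (h : ∀ α, hardyCoeff f α = hardyCoeff g α) :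
    f = g := by
  refine Subtype.ext (LInfTorus.ext_fourierCoeff fun α => ?_)
  by_cases hα : ∀ i, 0 ≤ α i
  · obtain ⟨β, rfl⟩ := exists_toIntIndex_eq hα
    exact h β
  · rw [f.2 α hα, g.2 α hα]

theorem LInfTorus.ae_norm_le (f : LInfTorus) : ∀ᵐ w ∂torusMeasure, ‖f w‖ ≤ ‖f‖ := by
  have h := ae_le_eLpNormEssSup (f := f) (μ := torusMeasure)
  filter_upwards [h] with w hw
  have h1 : ‖f‖ = (eLpNormEssSup f torusMeasure).toReal := by
    rw [Lp.norm_def, eLpNorm_exponent_top]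
  rw [h1, ← toReal_enorm]
  refine ENNReal.toReal_mono ?_ hw
  rw [← eLpNorm_exponent_top]
  exact (Lp.memLp f).2.ne

theorem LInfTorus.norm_le {f : LInfTorus} {C : ℝ} (hC : 0 ≤ C)
    (h : ∀ᵐ w ∂torusMeasure, ‖f w‖ ≤ C) : ‖f‖ ≤ C := by
  refine (Lp.norm_le_of_ae_bound hC h).trans_eq ?_
  simp

theorem norm_fourierCoeff_le (f : LInfTorus) (α : ℕ →₀ ℤ) : ‖fourierCoeff f α‖ ≤ ‖f‖ := by
  refine (norm_integral_le_of_norm_le_const (C := ‖f‖) ?_).trans (by simp)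
  filter_upwards [LInfTorus.ae_norm_le f] with w hw
  rw [norm_mul, norm_torusMonomial, mul_one]
  exact hw

end Fourier

/-! ### From the polytorus to the ball: the Poisson estimate -/

section Poisson

theorem hasSum_mul_of_summable_norm {ι κ : Type*} {f : ι → ℂ} {g : κ → ℂ} {s t : ℂ}
    (hf : HasSum f s) (hg : HasSum g t) (hfn : Summable fun i => ‖f i‖)
    (hgn : Summable fun i => ‖g i‖) : HasSum (fun p : ι × κ => f p.1 * g p.2) (s * t) := by
  have h : Summable fun p : ι × κ => f p.1 * g p.2 := by
    refine Summable.of_norm ?_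
    simp_rw [norm_mul]
    exact hfn.mul_of_nonneg hgn (fun _ => norm_nonneg _) fun _ => norm_nonneg _
  exact hf.mul hg h

/-- The Szegő kernel `∑ conj(z ^ α) w ^ α`. -/
noncomputable def szego (z : ℕ → ℂ) (w : Torus) : ℂ :=
  ∑' α : ℕ →₀ ℕ, starRingEnd ℂ (mono z α) * torusMonomial (toIntIndex α) w

theorem hasSum_szego_mul_conj {z : ℕ → ℂ} (hz : Summable fun α => ‖mono z α‖) (w : Torus) :
    HasSum (fun p : (ℕ →₀ ℕ) × (ℕ →₀ ℕ) => starRingEnd ℂ (mono z p.1) * mono z p.2 *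
      torusMonomial (toIntIndex p.1 - toIntIndex p.2) w)
      (szego z w * starRingEnd ℂ (szego z w)) := by
  have h1n : Summable fun α : ℕ →₀ ℕ =>
      ‖starRingEnd ℂ (mono z α) * torusMonomial (toIntIndex α) w‖ := by
    simpa [norm_torusMonomial] using hz
  have h1 : HasSum (fun α : ℕ →₀ ℕ => starRingEnd ℂ (mono z α) * torusMonomial (toIntIndex α) w)
      (szego z w) := h1n.of_norm.hasSum
  have h2 : HasSum (fun α : ℕ →₀ ℕ => starRingEnd ℂ
      (starRingEnd ℂ (mono z α) * torusMonomial (toIntIndex α) w)) (starRingEnd ℂ (szego z w)) :=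
    Complex.hasSum_conj'.2 (by simpa using h1)
  have h2n : Summable fun α : ℕ →₀ ℕ => ‖starRingEnd ℂ
      (starRingEnd ℂ (mono z α) * torusMonomial (toIntIndex α) w)‖ := by
    simpa [norm_torusMonomial] using hz
  have h3 := hasSum_mul_of_summable_norm h1 h2 h1n h2n
  convert h3 using 2 with p
  rw [map_mul, Complex.conj_conj, ← torusMonomial_neg, sub_eq_add_neg, torusMonomial_add]
  ring

/-- Expanding |K|² gives a double sum over (α, β) of conj(z^α) z^β f̂(β - α). Only β = α + γ with γ
≥ 0 survives, and z^{α+γ} = z^α z^γ makes the sum factor. -/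
theorem integral_mul_szego {f : Torus → ℂ} {C : ℝ} (hf : AEStronglyMeasurable f torusMeasure)
    (hC : ∀ᵐ w ∂torusMeasure, ‖f w‖ ≤ C)
    (hneg : ∀ α : ℕ →₀ ℤ, (¬ ∀ i, 0 ≤ α i) → ∫ w, f w * torusMonomial (-α) w ∂torusMeasure = 0)
    {z : ℕ → ℂ} (hz : Summable fun α => ‖mono z α‖) :
    ∫ w, f w * (szego z w * starRingEnd ℂ (szego z w)) ∂torusMeasure =
      (∑' α, starRingEnd ℂ (mono z α) * mono z α) *
        ∑' γ, (∫ w, f w * torusMonomial (-toIntIndex γ) w ∂torusMeasure) * mono z γ := by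
  have hfi : Integrable f torusMeasure :=
    Integrable.of_bound hf C hC
  set F : (ℕ →₀ ℕ) × (ℕ →₀ ℕ) → Torus → ℂ := fun p w =>
    f w * (starRingEnd ℂ (mono z p.1) * mono z p.2 *
      torusMonomial (toIntIndex p.1 - toIntIndex p.2) w) with hF
  set a : (ℕ →₀ ℤ) → ℂ := fun α => ∫ w, f w * torusMonomial (-α) w ∂torusMeasure with ha
  have hnF : ∀ p w, ‖F p w‖ = ‖mono z p.1‖ * ‖mono z p.2‖ * ‖f w‖ := by
    intro p w
    simp only [hF, norm_mul, norm_torusMonomial, mul_one, RCLike.norm_conj]; ring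
  have hFi : ∀ p, Integrable (F p) torusMeasure := fun p =>
    hfi.mul_bdd (c := ‖mono z p.1‖ * ‖mono z p.2‖)
      ((continuous_torusMonomial _).aestronglyMeasurable.const_mul _)
      (Eventually.of_forall fun w => by
        simp [norm_torusMonomial])
  have hpair : Summable fun p : (ℕ →₀ ℕ) × (ℕ →₀ ℕ) => ‖mono z p.1‖ * ‖mono z p.2‖ :=
    hz.mul_of_nonneg hz (fun _ => norm_nonneg _) fun _ => norm_nonneg _
  have hsum := hasSum_integral_of_summable_integral_norm hFi (by
    simp_rw [hnF, integral_const_mul]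
    exact hpair.mul_right _)
  have hint : ∀ p, ∫ w, F p w ∂torusMeasure =
      starRingEnd ℂ (mono z p.1) * mono z p.2 * a (toIntIndex p.2 - toIntIndex p.1) := by
    intro p
    simp only [ha, hF]
    rw [← integral_const_mul]
    refine integral_congr_ae (Eventually.of_forall fun w => ?_)
    simp only [neg_sub]; ring
  have htsum : ∀ w, ∑' p, F p w = f w * (szego z w * starRingEnd ℂ (szego z w)) := fun w =>
    ((hasSum_szego_mul_conj hz w).mul_left (f w)).tsum_eq
  simp_rw [hint, htsum] at hsum
  refine hsum.unique ?_
  have ha_le : ∀ α, ‖a α‖ ≤ C := fun α => by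
    refine (norm_integral_le_of_norm_le_const (C := C) ?_).trans (by simp)
    filter_upwards [hC] with w hw
    rwa [norm_mul, norm_torusMonomial, mul_one]
  have h1n : Summable fun α => ‖starRingEnd ℂ (mono z α) * mono z α‖ := by
    refine Summable.of_nonneg_of_le (fun _ => norm_nonneg _) (fun α => ?_)
      (hpair.comp_injective (i := fun α => (α, α)) fun α β h => (Prod.ext_iff.1 h).1)
    simp
  have h2n : Summable fun γ => ‖a (toIntIndex γ) * mono z γ‖ := by
    refine Summable.of_nonneg_of_le (fun _ => norm_nonneg _) (fun γ => ?_) (hz.mul_left C)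
    rw [norm_mul]
    gcongr
    exact ha_le _
  have hprod := hasSum_mul_of_summable_norm h1n.of_norm.hasSum h2n.of_norm.hasSum h1n h2n
  -- Reindexing by (α, γ) ↦ (α, α + γ): the pairs missed are those with β - α negative somewhere,
  -- where the coefficient of f vanishes.
  set φ : (ℕ →₀ ℕ) × (ℕ →₀ ℕ) → (ℕ →₀ ℕ) × (ℕ →₀ ℕ) := fun p => (p.1, p.1 + p.2) with hφ
  have hinj : Function.Injective φ := by
    rintro ⟨α, γ⟩ ⟨α', γ'⟩ h
    simp only [hφ, Prod.mk.injEq] at h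
    obtain ⟨rfl, h⟩ := h
    simpa using h
  refine (hinj.hasSum_iff ?_).1 ?_
  · rintro ⟨α, β⟩ hp
    have : ¬ ∀ i, 0 ≤ (toIntIndex β - toIntIndex α) i := by
      intro h
      refine hp ⟨(α, β - α), ?_⟩
      simp only [hφ, Prod.mk.injEq, true_and]
      refine add_tsub_cancel_of_le fun i => ?_
      have := h i
      rw [Finsupp.sub_apply, toIntIndex_apply, toIntIndex_apply] at this
      omega
    simp only
    rw [show a (toIntIndex β - toIntIndex α) = 0 from hneg _ this, mul_zero]
  · refine hprod.congr_fun fun p => ?_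
    simp only [hφ, Function.comp_apply, mono_add, toIntIndex_add, add_sub_cancel_left]
    ring

/-- The Poisson estimate: the power series with the Fourier coefficients of `f ∈ H_∞(𝕋^∞)` is
bounded by `‖f‖` at finitely supported points of the polydisc. -/
theorem norm_tsum_hardyCoeff_le (f : HInfTorus) {z : ℕ → ℂ} (hz : Summable fun α => ‖mono z α‖) :
    ‖∑' α, hardyCoeff f α * mono z α‖ ≤ ‖f‖ := by
  -- The constant function 1 yields ∫ |K|² = S, which normalizes the Poisson kernel |K|²/S.
  have hS := integral_mul_szego (f := fun _ => 1) (C := 1) aestronglyMeasurable_const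
    (Eventually.of_forall fun _ => by simp) (fun α hα => by
      simp only [one_mul]
      rw [integral_torusMonomial, if_neg]
      rw [neg_eq_zero]
      rintro rfl
      simp at hα) hz
  have hG := integral_mul_szego (f := ((f : LInfTorus) : Torus → ℂ)) (C := ‖f‖)
    (Lp.aestronglyMeasurable _) (LInfTorus.ae_norm_le f) f.2 hz
  set S := ∑' α, starRingEnd ℂ (mono z α) * mono z α with hSdef
  have hone : ∑' γ, (∫ w, (1 : ℂ) * torusMonomial (-toIntIndex γ) w ∂torusMeasure) * mono z γ
      = 1 := by
    rw [tsum_eq_single 0]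
    · simp only [one_mul]
      rw [integral_torusMonomial, if_pos (by simp [toIntIndex]), mono_zero, one_mul]
    · intro γ hγ
      simp only [one_mul]
      rw [integral_torusMonomial, if_neg, zero_mul]
      rw [neg_eq_zero]
      exact fun h => hγ (toIntIndex_injective (h.trans (by simp [toIntIndex])))
  rw [hone, mul_one] at hS
  change _ = S * ∑' α, hardyCoeff f α * mono z α at hG
  have hKK : ∀ w, szego z w * starRingEnd ℂ (szego z w) = ((‖szego z w‖ ^ 2 : ℝ) : ℂ) := fun w => by
    rw [Complex.mul_conj, Complex.normSq_eq_norm_sq]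
  have hS0 : S = ((∑' α, ‖mono z α‖ ^ 2 : ℝ) : ℂ) := by
    rw [Complex.ofReal_tsum]
    refine tsum_congr fun α => ?_
    rw [mul_comm, Complex.mul_conj, Complex.normSq_eq_norm_sq]
  have hsq : Summable fun α => ‖mono z α‖ ^ 2 := by
    simp_rw [pow_two]
    exact (hz.mul_of_nonneg hz (fun _ => norm_nonneg _) fun _ => norm_nonneg _).comp_injective
      (i := fun α => (α, α)) fun α β h => (Prod.ext_iff.1 h).1
  have hSpos : 0 < ∑' α, ‖mono z α‖ ^ 2 :=
    hsq.tsum_pos (fun _ => by positivity) 0 (by simp [mono_zero])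
  simp_rw [one_mul, hKK] at hS
  rw [integral_complex_ofReal, hS0] at hS
  have hSr : ∫ w, ‖szego z w‖ ^ 2 ∂torusMeasure = ∑' α, ‖mono z α‖ ^ 2 := by exact_mod_cast hS
  -- A non-integrable function has integral 0 by convention, so the positive value of the integral
  -- forces integrability.
  have hKint : Integrable (fun w => ‖szego z w‖ ^ 2) torusMeasure :=
    not_imp_comm.1 integral_undef (hSr ▸ hSpos.ne')
  have hle : ‖∫ w, (f : LInfTorus) w * (szego z w * starRingEnd ℂ (szego z w)) ∂torusMeasure‖ ≤
      ‖f‖ * ∑' α, ‖mono z α‖ ^ 2 := by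
    rw [← hSr, ← integral_const_mul]
    refine norm_integral_le_of_norm_le (hKint.const_mul _) ?_
    filter_upwards [LInfTorus.ae_norm_le f] with w hw
    rw [hKK, norm_mul, Complex.norm_of_nonneg (by positivity)]
    gcongr
    exact hw
  rw [hG, norm_mul, hS0, Complex.norm_of_nonneg hSpos.le, mul_comm] at hle
  exact le_of_mul_le_mul_right hle hSpos

/-! ### Holomorphy of power series with bounded coefficients in finitely many variables -/

theorem norm_hardyCoeff_le (f : HInfTorus) (α : ℕ →₀ ℕ) : ‖hardyCoeff f α‖ ≤ ‖f‖ :=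
  norm_fourierCoeff_le _ _

theorem summable_norm_mono_cut {x : CZero} (hx : ‖x‖ < 1) (n : ℕ) :
    Summable fun α => ‖mono (cut n x) α‖ :=
  summable_norm_mono (n := n)
    (fun i => ((norm_apply_le _ i).trans (norm_cut_coe_le n x)).trans_lt hx)
    fun i hi => by rw [cut_apply, if_neg (not_lt.2 hi)]

theorem norm_mono_le {u v : ℕ → ℂ} (h : ∀ i, ‖u i‖ ≤ ‖v i‖) (α : ℕ →₀ ℕ) :
    ‖mono u α‖ ≤ ‖mono v α‖ := by
  rw [norm_mono, norm_mono]
  exact Finset.prod_le_prod (fun i _ => by positivity) fun i _ => by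
    exact pow_le_pow_left₀ (norm_nonneg _) (h i) _

theorem differentiable_mono_cut (n : ℕ) (α : ℕ →₀ ℕ) :
    Differentiable ℂ fun x : CZero => mono (cut n x) α := by
  have h : ∀ i, ContDiff ℂ 1 fun x : CZero => cut n x i := fun i =>
    ((coord i).comp (trunc n)).contDiff
  change Differentiable ℂ fun x : CZero => ∏ i ∈ α.support, cut n x i ^ α i
  exact (contDiff_prod fun i _ => (h i).pow _).differentiable one_ne_zero

theorem differentiableOn_tsum_mono_cut {c : (ℕ →₀ ℕ) → ℂ} {M : ℝ} (hc : ∀ α, ‖c α‖ ≤ M) (n : ℕ) :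
    DifferentiableOn ℂ (fun x : CZero => ∑' α, c α * mono (cut n x) α) (Metric.ball 0 1) := by
  have hM : 0 ≤ M := (norm_nonneg _).trans (hc 0)
  intro x hx
  rw [mem_ball_zero_iff] at hx
  obtain ⟨r, hxr, hr1⟩ := exists_between hx
  have hr0 : 0 ≤ r := (norm_nonneg _).trans hxr.le
  refine DifferentiableAt.differentiableWithinAt
    (DifferentiableOn.differentiableAt (s := Metric.ball 0 r) ?_
      (Metric.isOpen_ball.mem_nhds (mem_ball_zero_iff.2 hxr)))
  -- The point (r, …, r, 0, …) dominates every truncated point of the ball of radius r, so M |ρ^α|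
  -- is a summable majorant there. The partial sums are then uniformly bounded.
  set ρ : CZero := cut n fun _ => (r : ℂ) with hρ
  have hρn : ∀ i, ‖ρ i‖ = if i < n then r else 0 := fun i => by
    rw [hρ, cut_apply]
    split_ifs <;> simp [abs_of_nonneg hr0]
  have hρs : Summable fun α => ‖mono ρ α‖ := by
    refine summable_norm_mono (n := n) (fun i => ?_) fun i hi => ?_
    · rw [hρn]; split_ifs <;> linarith
    · rw [hρ, cut_apply, if_neg (not_lt.2 hi)]
  have hle : ∀ y ∈ Metric.ball (0 : CZero) r, ∀ α, ‖c α * mono (cut n y) α‖ ≤ M * ‖mono ρ α‖ := by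
    intro y hy α
    rw [mem_ball_zero_iff] at hy
    rw [norm_mul]
    gcongr
    · exact hc α
    · refine norm_mono_le (fun i => ?_) α
      rw [hρn, cut_apply]
      split_ifs
      · exact (norm_apply_le y i).trans hy.le
      · simp
  refine differentiableOn_of_tendsto_of_norm_le (l := (atTop : Filter (Finset (ℕ →₀ ℕ))))
    (F := fun s (y : CZero) => ∑ α ∈ s, c α * mono (cut n (y : ℕ → ℂ)) α) (M := ∑' α, M * ‖mono ρ α‖)
    Metric.isOpen_ball ?_ ?_ ?_
  · intro s
    refine Differentiable.differentiableOn ?_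
    have := differentiable_mono_cut n
    fun_prop
  · intro s y hy
    refine (norm_sum_le _ _).trans ((Finset.sum_le_sum fun α _ => hle y hy α).trans ?_)
    exact (hρs.mul_left M).sum_le_tsum _ fun _ _ => by positivity
  · intro y hy
    exact (Summable.of_norm_bounded (hρs.mul_left M) (hle y hy)).hasSum

/-- A bounded holomorphic function on the ball, built from a differentiable bounded function. -/
noncomputable def HInfBall.mk' (G : CZero → ℂ) (hG : DifferentiableOn ℂ G (Metric.ball 0 1)) (M : ℝ)
    (hM : ∀ x ∈ Metric.ball (0 : CZero) 1, ‖G x‖ ≤ M) : HInfBall :=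
  ⟨BoundedContinuousFunction.ofNormedAddCommGroup (fun x : CZeroBall => G x)
    (continuousOn_iff_continuous_domRestrict.1 hG.continuousOn) M fun x => hM x x.2,
    ⟨G, hG, fun _ => rfl⟩⟩

theorem HInfBall.norm_mk'_le {G : CZero → ℂ} (hG : DifferentiableOn ℂ G (Metric.ball 0 1)) {M : ℝ}
    (hM : ∀ x ∈ Metric.ball (0 : CZero) 1, ‖G x‖ ≤ M) : ‖HInfBall.mk' G hG M hM‖ ≤ M :=
  BoundedContinuousFunction.norm_ofNormedAddCommGroup_le _
    ((norm_nonneg _).trans (hM 0 (Metric.mem_ball_self one_pos))) fun x : CZeroBall => hM (x : CZero) x.2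

/-- Every `f ∈ H_∞(𝕋^∞)` gives a bounded holomorphic function with the same coefficients. -/
theorem exists_holomorphic_of_hardy (f : HInfTorus) :
    ∃ g : HInfBall, ‖g‖ ≤ ‖f‖ ∧ IsMonomialCoeff g (hardyCoeff f) := by
  -- The Poisson estimate bounds the truncated series by ‖f‖ uniformly in n. At a finitely supported
  -- point the truncations are eventually constant, so any cluster point has the right value there.
  obtain ⟨G, hG, hGM, hGlim⟩ := exists_differentiableOn_of_norm_le
    (F := fun n (x : CZero) => ∑' α, hardyCoeff f α * mono (cut n (x : ℕ → ℂ)) α)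
    (U := Metric.ball (0 : CZero) 1) (M := ‖f‖) Metric.isOpen_ball
    (fun n => differentiableOn_tsum_mono_cut (norm_hardyCoeff_le f) n)
    (fun n x hx => norm_tsum_hardyCoeff_le f (summable_norm_mono_cut (mem_ball_zero_iff.1 hx) n))
  refine ⟨HInfBall.mk' G hG _ hGM, HInfBall.norm_mk'_le hG hGM, fun k z hz => ?_⟩
  have hcut : ∀ n, k ≤ n → cut n (z : CZero) = z := fun n hn =>
    cut_eq_self fun i hi => hz i (hn.trans hi)
  have hzn := mem_ball_zero_iff.1 z.2
  have hs : Summable fun α => hardyCoeff f α * mono (z : CZero) α := by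
    have h1 := summable_norm_mono_cut hzn k
    rw [hcut k le_rfl] at h1
    refine Summable.of_norm_bounded (h1.mul_left ‖f‖) fun α => ?_
    rw [norm_mul]
    gcongr
    exact norm_hardyCoeff_le f α
  have hval : G z = ∑' α, hardyCoeff f α * mono (z : CZero) α := by
    refine hGlim z z.2 _ (tendsto_const_nhds.congr' ?_)
    filter_upwards [eventually_ge_atTop k] with n hn
    rw [hcut n hn]
  change HasSum _ (G z)
  rw [hval]
  exact hs.hasSum

end Poisson

/-! ### Monomial expansions of bounded holomorphic functions -/

section Expansion

/-- Cauchy estimates and Taylor expansion of a bounded holomorphic function on the unit disc. -/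
theorem hasSum_taylor_unit_disc {f : ℂ → ℂ} {M : ℝ} (hf : DifferentiableOn ℂ f (Metric.ball 0 1))
    (hM : ∀ z ∈ Metric.ball (0 : ℂ) 1, ‖f z‖ ≤ M) :
    (∀ k : ℕ, ‖(k.factorial : ℂ)⁻¹ * iteratedDeriv k f 0‖ ≤ M) ∧
      ∀ z ∈ Metric.ball (0 : ℂ) 1,
        HasSum (fun k : ℕ => (k.factorial : ℂ)⁻¹ * iteratedDeriv k f 0 * z ^ k) (f z) := by
  refine ⟨fun k => ?_, fun z hz => ?_⟩
  -- Cauchy's estimate on circles of radius R < 1; letting R → 1 removes the factor R^{-k}.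
  · have h1 : ∀ R ∈ Ioo (0 : ℝ) 1, ‖(k.factorial : ℂ)⁻¹ * iteratedDeriv k f 0‖ ≤ M / R ^ k := by
      intro R hR
      have hsub : Metric.closedBall (0 : ℂ) R ⊆ Metric.ball 0 1 :=
        Metric.closedBall_subset_ball hR.2
      have h2 := Complex.norm_iteratedDeriv_le_of_forall_mem_sphere_norm_le (c := 0) k hR.1
        ((hf.mono hsub).diffContOnCl_ball (subset_refl _))
        fun z hz => hM z (hsub (Metric.sphere_subset_closedBall hz))
      rw [norm_mul, norm_inv, Complex.norm_natCast]
      have hk : (0 : ℝ) < k.factorial := by positivity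
      calc (k.factorial : ℝ)⁻¹ * ‖iteratedDeriv k f 0‖
          ≤ (k.factorial : ℝ)⁻¹ * (k.factorial * M / R ^ k) := by gcongr
        _ = M / R ^ k := by field_simp
    have h3 : Tendsto (fun R : ℝ => M / R ^ k) (𝓝[<] 1) (𝓝 (M / 1 ^ k)) := by
      refine Tendsto.mono_left ?_ nhdsWithin_le_nhds
      exact tendsto_const_nhds.div ((continuous_pow k).tendsto 1) (by simp)
    rw [one_pow, div_one] at h3
    refine ge_of_tendsto h3 ?_
    filter_upwards [Ioo_mem_nhdsLT (zero_lt_one (α := ℝ))] with R hR using h1 R hR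
  · refine (Complex.hasSum_taylorSeries_on_ball hf hz).congr_fun fun k => ?_
    simp only [sub_zero, smul_eq_mul]; ring

/-- If `∑ a_k(x) t ^ k` is holomorphic in `x` for every small `t > 0` and the coefficients are
uniformly bounded, then the coefficients are holomorphic. -/
theorem differentiableOn_coeff {E : Type*} [NormedAddCommGroup E] [NormedSpace ℂ E] {U : Set E}
    (hU : IsOpen U) {a : ℕ → E → ℂ} {F : ℝ → E → ℂ} {M : ℝ}
    (hF : ∀ t ∈ Ioc (0 : ℝ) (1 / 2), DifferentiableOn ℂ (F t) U) (ha : ∀ k, ∀ x ∈ U, ‖a k x‖ ≤ M)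
    (hs : ∀ t ∈ Ioc (0 : ℝ) (1 / 2), ∀ x ∈ U, HasSum (fun k => a k x * (t : ℂ) ^ k) (F t x)) (k : ℕ) :
    DifferentiableOn ℂ (a k) U := by
  induction k using Nat.strong_induction_on with
  | _ k ih =>
  set t : ℕ → ℝ := fun j => 1 / (j + 2) with ht
  have htI : ∀ j, t j ∈ Ioc (0 : ℝ) (1 / 2) := fun j => by
    have : (0 : ℝ) ≤ j := Nat.cast_nonneg j
    exact ⟨by positivity, one_div_le_one_div_of_le two_pos (by linarith)⟩
  have htlim : Tendsto t atTop (𝓝 0) := by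
    refine squeeze_zero (fun j => (htI j).1.le) (fun j => ?_) tendsto_one_div_add_atTop_nhds_zero_nat
    exact one_div_le_one_div_of_le (by positivity) (by linarith)
  -- Removing the terms below k, holomorphic by induction, and dividing by t^k leaves a_k + O(t),
  -- with error at most M t/(1 - t) ≤ 2 M t for t ≤ 1/2. Thus a_k is a bounded limit of holomorphic
  -- functions.
  set R : ℕ → E → ℂ := fun j x =>
    (F (t j) x - ∑ i ∈ Finset.range k, a i x * (t j : ℂ) ^ i) / (t j : ℂ) ^ k with hR
  have hRdiff : ∀ j, DifferentiableOn ℂ (R j) U := by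
    intro j
    have h1 : DifferentiableOn ℂ (fun x => ∑ i ∈ Finset.range k, a i x * (t j : ℂ) ^ i) U :=
      DifferentiableOn.fun_sum fun i hi => (ih i (Finset.mem_range.1 hi)).mul_const _
    have := ((hF _ (htI j)).sub h1).mul_const (((t j : ℂ) ^ k)⁻¹)
    exact this
  have hRs : ∀ j, ∀ x ∈ U, HasSum (fun i => a (i + k) x * (t j : ℂ) ^ i) (R j x) := by
    intro j x hx
    have htj : (t j : ℂ) ^ k ≠ 0 := pow_ne_zero _ (by exact_mod_cast (htI j).1.ne')
    have h1 := ((hasSum_nat_add_iff' k).2 (hs _ (htI j) x hx)).div_const ((t j : ℂ) ^ k)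
    refine h1.congr_fun fun i => ?_
    rw [pow_add]; field_simp
  have hnt : ∀ j, ‖(t j : ℂ)‖ = t j := fun j => by
    rw [Complex.norm_real, Real.norm_of_nonneg (htI j).1.le]
  have hgeo : ∀ j, HasSum (fun i : ℕ => M * t j ^ i) (M * (1 - t j)⁻¹) := fun j =>
    (hasSum_geometric_of_lt_one (htI j).1.le (by linarith [(htI j).2])).mul_left M
  have hdiff : ∀ j, ∀ x ∈ U, ‖R j x - a k x‖ ≤ 2 * M * t j := by
    intro j x hx
    have hM : 0 ≤ M := (norm_nonneg _).trans (ha 0 x hx)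
    have h1 := (hasSum_nat_add_iff' 1).2 (hRs j x hx)
    have h2 := (hgeo j).mul_right (t j)
    simp only [Finset.range_one, Finset.sum_singleton, pow_zero, mul_one, zero_add] at h1
    rw [← h1.tsum_eq]
    refine (tsum_of_norm_bounded h2 fun i => ?_).trans ?_
    · rw [norm_mul, norm_pow, hnt, pow_succ, ← mul_assoc]
      have := ha (i + 1 + k) x hx
      have h0 := (htI j).1.le
      gcongr
    · have h0 := (htI j).1.le
      have : (1 - t j)⁻¹ ≤ 2 := by
        rw [inv_le_comm₀ (by linarith [(htI j).2]) two_pos]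
        linarith [(htI j).2]
      calc M * (1 - t j)⁻¹ * t j ≤ M * 2 * t j := by gcongr
        _ = _ := by ring
  refine differentiableOn_of_tendsto_of_norm_le (l := atTop) (F := R) (M := 2 * M) hU hRdiff
    (fun j x hx => ?_) fun x hx => ?_
  · have hM : 0 ≤ M := (norm_nonneg _).trans (ha 0 x hx)
    have h1 := hdiff j x hx
    have h2 : 2 * M * t j ≤ M := by nlinarith [(htI j).2]
    calc ‖R j x‖ = ‖(R j x - a k x) + a k x‖ := by rw [sub_add_cancel]
      _ ≤ M + M := (norm_add_le _ _).trans (add_le_add (h1.trans h2) (ha k x hx))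
      _ = 2 * M := by ring
  · rw [tendsto_iff_norm_sub_tendsto_zero]
    refine squeeze_zero (fun _ => norm_nonneg _) (fun j => hdiff j x hx) ?_
    simpa using htlim.const_mul (2 * M)

theorem norm_cut_add_smul_unitVec_lt {x : CZero} {ζ : ℂ} (hx : ‖x‖ < 1) (hζ : ‖ζ‖ < 1) (n : ℕ) :
    ‖cut n x + ζ • unitVec n‖ < 1 := by
  refine lt_of_le_of_lt (CZero.norm_le (C := max ‖x‖ ‖ζ‖) (le_max_of_le_left (norm_nonneg _))
    fun i => ?_) (max_lt hx hζ)
  change ‖cut n x i + ζ * unitVec n i‖ ≤ _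
  rw [cut_apply, unitVec_apply]
  rcases lt_trichotomy i n with h | h | h
  · simpa [h, h.ne] using Or.inl (norm_apply_le x i)
  · subst h; simp
  · simp [h.not_gt, h.ne']

theorem cut_add_smul_unitVec {n : ℕ} {x : CZero} (h : ∀ i, n + 1 ≤ i → x i = 0) :
    cut n x + x n • unitVec n = x := by
  ext i
  change cut n x i + x n * unitVec n i = x i
  rw [cut_apply, unitVec_apply]
  rcases lt_trichotomy i n with hi | hi | hi
  · simp [hi, hi.ne]
  · subst hi; simp
  · simp [hi.not_gt, hi.ne', h i hi]

theorem mono_erase_mul_pow (u : ℕ → ℂ) (α : ℕ →₀ ℕ) (n : ℕ) :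
    mono u (α.erase n) * u n ^ α n = mono u α := by
  rw [← mono_single, ← mono_add, Finsupp.erase_add_single]

/-- A bounded holomorphic function on the ball has a monomial expansion in the first `n`
variables. -/
theorem exists_expansion {M : ℝ} (n : ℕ) : ∀ F : CZero → ℂ,
    DifferentiableOn ℂ F (Metric.ball 0 1) → (∀ x ∈ Metric.ball (0 : CZero) 1, ‖F x‖ ≤ M) →
    ∃ c : (ℕ →₀ ℕ) → ℂ, (∀ α, ‖c α‖ ≤ M) ∧ (∀ α i, n ≤ i → α i ≠ 0 → c α = 0) ∧
      ∀ z ∈ Metric.ball (0 : CZero) 1, (∀ i, n ≤ i → z i = 0) →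
        HasSum (fun α => c α * mono z α) (F z) := by
  classical
  induction n with
  | zero =>
    intro F _ hM
    have h0 := hM 0 (Metric.mem_ball_self one_pos)
    refine ⟨fun α => if α = 0 then F 0 else 0, fun α => ?_, fun α i _ hi => ?_, fun z _ hz => ?_⟩
    · simp only
      split_ifs
      · exact h0
      · simpa using (norm_nonneg _).trans h0
    · exact if_neg fun h => hi (by simp [h])
    · have hz0 : z = 0 := by ext i; exact hz i (Nat.zero_le i)
      subst hz0
      convert hasSum_ite_eq (0 : ℕ →₀ ℕ) (F 0) using 2 with α
      split_ifs with h
      · subst h; simp [mono_zero]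
      · simp [h]
  | succ n ih =>
    intro F hF hM
    have hM0 : 0 ≤ M := (norm_nonneg _).trans (hM 0 (Metric.mem_ball_self one_pos))
    have hmem : ∀ x ∈ Metric.ball (0 : CZero) 1, ∀ ζ ∈ Metric.ball (0 : ℂ) 1,
        cut n x + ζ • unitVec n ∈ Metric.ball (0 : CZero) 1 := fun x hx ζ hζ =>
      mem_ball_zero_iff.2 (norm_cut_add_smul_unitVec_lt (mem_ball_zero_iff.1 hx)
        (mem_ball_zero_iff.1 hζ) n)
    -- Taylor coefficients in the variable of index n, as functions of the earlier variables. They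
    -- are bounded by M and holomorphic, so the induction hypothesis expands each of them.
    set a : ℕ → CZero → ℂ := fun k x => (k.factorial : ℂ)⁻¹ *
      iteratedDeriv k (fun ζ : ℂ => F (cut n x + ζ • unitVec n)) 0 with ha
    have key := fun x (hx : x ∈ Metric.ball (0 : CZero) 1) =>
      hasSum_taylor_unit_disc (f := fun ζ : ℂ => F (cut n x + ζ • unitVec n)) (M := M)
        (hF.comp (by fun_prop) fun ζ hζ => hmem x hx ζ hζ) fun ζ hζ => hM _ (hmem x hx ζ hζ)
    have hadiff : ∀ k, DifferentiableOn ℂ (a k) (Metric.ball 0 1) := by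
      have hIoc : ∀ t ∈ Ioc (0 : ℝ) (1 / 2), (t : ℂ) ∈ Metric.ball (0 : ℂ) 1 := fun t ht => by
        rw [mem_ball_zero_iff, Complex.norm_real, Real.norm_of_nonneg ht.1.le]
        linarith [ht.2]
      refine differentiableOn_coeff Metric.isOpen_ball (M := M)
        (F := fun t (x : CZero) => F (cut n x + (t : ℂ) • unitVec n)) (fun t ht => ?_)
        (fun k x hx => (key x hx).1 k) fun t ht x hx => (key x hx).2 _ (hIoc t ht)
      exact hF.comp (((trunc n).differentiable.add_const _).differentiableOn)
        fun x hx => hmem x hx _ (hIoc t ht)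
    choose c hcM hc0 hcs using fun k => ih (a k) (hadiff k) fun x hx => (key x hx).1 k
    refine ⟨fun α => c (α n) (α.erase n), fun α => hcM _ _, fun α i hi hαi => ?_, fun z hz hz0 => ?_⟩
    · exact hc0 _ _ i (by omega) (by rw [Finsupp.erase_ne (by omega)]; exact hαi)
    · set z' : CZero := cut n z with hz'
      have hz'1 : z' ∈ Metric.ball (0 : CZero) 1 :=
        mem_ball_zero_iff.2 ((norm_cut_coe_le n z).trans_lt (mem_ball_zero_iff.1 hz))
      have hz'0 : ∀ i, n ≤ i → z' i = 0 := fun i hi => by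
        rw [hz', cut_apply, if_neg (not_lt.2 hi)]
      have hcut : cut n z' = z' := cut_eq_self hz'0
      have hzn : z n ∈ Metric.ball (0 : ℂ) 1 :=
        mem_ball_zero_iff.2 ((norm_apply_le z n).trans_lt (mem_ball_zero_iff.1 hz))
      have hout := (key z' hz'1).2 (z n) hzn
      simp only [hcut] at hout
      rw [hz', cut_add_smul_unitVec hz0, ← hz'] at hout
      have hin : ∀ k, HasSum (fun β => c k β * mono z' β * z n ^ k) (a k z' * z n ^ k) := fun k =>
        (hcs k z' hz'1 hz'0).mul_right _
      have hs' : Summable fun β => ‖mono z' β‖ :=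
        summable_norm_mono_cut (mem_ball_zero_iff.1 hz) n
      have hgeo : Summable fun k : ℕ => ‖z n‖ ^ k :=
        summable_geometric_of_lt_one (norm_nonneg _) (mem_ball_zero_iff.1 hzn)
      have hpair : Summable fun p : ℕ × (ℕ →₀ ℕ) => c p.1 p.2 * mono z' p.2 * z n ^ p.1 := by
        have h1 : Summable fun p : ℕ × (ℕ →₀ ℕ) => ‖z n‖ ^ p.1 * ‖mono z' p.2‖ :=
          hgeo.mul_of_nonneg hs' (fun _ => by positivity) fun _ => norm_nonneg _
        refine Summable.of_norm_bounded (h1.mul_left M) fun p => ?_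
        rw [norm_mul, norm_mul, norm_pow]
        calc ‖c p.1 p.2‖ * ‖mono z' p.2‖ * ‖z n‖ ^ p.1 ≤ M * ‖mono z' p.2‖ * ‖z n‖ ^ p.1 := by
              gcongr; exact hcM _ _
          _ = _ := by ring
      have hF' : F z = ∑' p : ℕ × (ℕ →₀ ℕ), c p.1 p.2 * mono z' p.2 * z n ^ p.1 := by
        refine hout.unique ?_
        have h1 := hpair.hasSum.prod_fiberwise hin
        simpa only [ha, hcut] using h1
      rw [hF']
      -- A multi-index is split into its n-th exponent and the rest. A pair (k, β) outside the range
      -- has β n ≠ 0, and there c k β = 0.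
      set φ : (ℕ →₀ ℕ) → ℕ × (ℕ →₀ ℕ) := fun α => (α n, α.erase n) with hφ
      have hinj : Function.Injective φ := fun α β h => by
        simp only [hφ, Prod.mk.injEq] at h
        rw [← Finsupp.erase_add_single n α, ← Finsupp.erase_add_single n β, h.1, h.2]
      have h2 := (hinj.hasSum_iff (f := fun p : ℕ × (ℕ →₀ ℕ) => c p.1 p.2 * mono z' p.2 * z n ^ p.1)
        (a := ∑' p : ℕ × (ℕ →₀ ℕ), c p.1 p.2 * mono z' p.2 * z n ^ p.1) ?_).2 hpair.hasSum
      · refine h2.congr_fun fun α => ?_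
        simp only [hφ, Function.comp_apply]
        rw [mul_assoc]
        by_cases hα : ∃ i, n + 1 ≤ i ∧ α i ≠ 0
        · obtain ⟨i, hi, hαi⟩ := hα
          rw [hc0 _ _ i (by omega) (by rw [Finsupp.erase_ne (by omega)]; exact hαi), zero_mul,
            zero_mul]
        · push Not at hα
          rw [← mono_erase_mul_pow]
          congr 2
          refine mono_congr fun i hi => ?_
          have hin : i ≠ n := by rintro rfl; simp at hi
          rw [Finsupp.erase_ne hin] at hi
          have : i < n := by
            by_contra hlt
            exact hi (hα i (by omega))
          rw [hz', cut_apply, if_pos this]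
      · rintro ⟨k, β⟩ hp
        have hβ : β n ≠ 0 := by
          intro hβ
          refine hp ⟨β + Finsupp.single n k, ?_⟩
          simp only [hφ, Finsupp.add_apply, hβ, Finsupp.single_eq_same, zero_add, Finsupp.erase_add,
            Finsupp.erase_single, add_zero]
          rw [Finsupp.erase_of_notMem_support (by simpa using hβ)]
        simp only
        rw [hc0 k β n le_rfl hβ, zero_mul, zero_mul]

end Expansion

/-! ### From the ball to the polytorus -/

section Boundary

/-- Fourier coefficients of an absolutely convergent power series on the polytorus. -/
theorem integral_of_hasSum_mono {b : (ℕ →₀ ℕ) → ℂ} (hb : Summable fun α => ‖b α‖) {f : Torus → ℂ}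
    (hf : ∀ w, HasSum (fun α => b α * torusMonomial (toIntIndex α) w) (f w)) :
    (∀ α, ∫ w, f w * torusMonomial (-toIntIndex α) w ∂torusMeasure = b α) ∧
      ∀ β : ℕ →₀ ℤ, (∀ α, toIntIndex α ≠ β) →
        ∫ w, f w * torusMonomial (-β) w ∂torusMeasure = 0 := by
  classical
  -- Absolute convergence permits termwise integration; orthogonality leaves at most one term.
  have key : ∀ β : ℕ →₀ ℤ, HasSum (fun α => if toIntIndex α = β then b α else 0)
      (∫ w, f w * torusMonomial (-β) w ∂torusMeasure) := by
    intro β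
    have hF : ∀ α w, b α * torusMonomial (toIntIndex α) w * torusMonomial (-β) w =
        b α * torusMonomial (toIntIndex α - β) w := fun α w => by
      rw [mul_assoc, ← torusMonomial_add, sub_eq_add_neg]
    have h1 := hasSum_integral_of_summable_integral_norm (μ := torusMeasure)
      (F := fun (α : ℕ →₀ ℕ) (w : Torus) => b α * torusMonomial (toIntIndex α - β) w)
      (fun α => Integrable.of_bound
        ((continuous_torusMonomial _).aestronglyMeasurable.const_mul _) ‖b α‖
        (Eventually.of_forall fun w => by simp [norm_torusMonomial]))
      (by simpa [norm_torusMonomial] using hb)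
    have h2 : ∀ w, ∑' α, b α * torusMonomial (toIntIndex α - β) w = f w * torusMonomial (-β) w :=
      fun w => by
        simp_rw [← hF]
        exact ((hf w).mul_right _).tsum_eq
    simp_rw [h2] at h1
    refine h1.congr_fun fun α => ?_
    rw [integral_const_mul, integral_torusMonomial]
    simp [sub_eq_zero]
  refine ⟨fun α => ?_, fun β hβ => ?_⟩
  · refine (key (toIntIndex α)).unique ?_
    convert! hasSum_ite_eq α (b α) using 2 with γ
    simp only [toIntIndex_injective.eq_iff]
    split_ifs with h
    · rw [h]
    · rfl
  · refine (key β).unique ?_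
    simp [hβ, hasSum_zero]

/-- The point `(r w_0, …, r w_{n-1}, 0, …)`. -/
noncomputable def scaled (n : ℕ) (r : ℝ) (w : Torus) : CZero := cut n fun i => (r : ℂ) * (w i : ℂ)

theorem scaled_mem_ball {n : ℕ} {r : ℝ} (h0 : 0 ≤ r) (h1 : r < 1) (w : Torus) :
    scaled n r w ∈ Metric.ball (0 : CZero) 1 := by
  rw [mem_ball_zero_iff]
  refine (norm_cut_le h0 fun i _ => ?_).trans_lt h1
  simp [abs_of_nonneg h0, Circle.norm_coe]

theorem scaled_apply_eq_zero {n : ℕ} {r : ℝ} {w : Torus} {i : ℕ} (hi : n ≤ i) :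
    scaled n r w i = 0 := by
  rw [scaled, cut_apply, if_neg (not_lt.2 hi)]

theorem continuous_scaled (n : ℕ) (r : ℝ) : Continuous (scaled n r) := by
  have : scaled n r = fun w => ∑ i ∈ Finset.range n, ((r : ℂ) * (w i : ℂ)) • unitVec i :=
    funext fun w => cut_eq_sum _ _
  rw [this]
  refine continuous_finsetSum _ fun i _ => ?_
  have : Continuous fun w : Torus => (w i : ℂ) := continuous_subtype_val.comp (continuous_apply i)
  exact (continuous_const.mul this).smul continuous_const

/-- The factor `r ^ |α|` if `α` is supported in the first `n` entries, and `0` otherwise. -/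
noncomputable def damp (n : ℕ) (r : ℝ) (α : ℕ →₀ ℕ) : ℂ := mono (cut n fun _ => (r : ℂ)) α

theorem mono_scaled (n : ℕ) (r : ℝ) (w : Torus) (α : ℕ →₀ ℕ) :
    mono (scaled n r w) α = damp n r α * torusMonomial (toIntIndex α) w := by
  rw [torusMonomial_toIntIndex, damp, ← mono_mul, scaled]
  refine mono_congr fun i _ => ?_
  simp only [cut_apply]
  split_ifs <;> simp

theorem damp_eq {n : ℕ} {α : ℕ →₀ ℕ} (h : ∀ i, n ≤ i → α i = 0) (r : ℝ) :
    damp n r α = (r : ℂ) ^ α.degree := by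
  rw [damp, mono_cut, if_pos h, mono_const]

theorem norm_damp_le_one {n : ℕ} {r : ℝ} (h0 : 0 ≤ r) (h1 : r ≤ 1) (α : ℕ →₀ ℕ) :
    ‖damp n r α‖ ≤ 1 := by
  classical
  rw [damp, mono_cut]
  split_ifs
  · rw [mono_const, norm_pow, Complex.norm_real, Real.norm_of_nonneg h0]
    exact pow_le_one₀ h0 h1
  · simp

/-- `F` has the monomial expansion with coefficients `c` in the first `n` variables. -/
def HasExpansion (F : CZero → ℂ) (n : ℕ) (c : (ℕ →₀ ℕ) → ℂ) : Prop :=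
  ∀ z ∈ Metric.ball (0 : CZero) 1, (∀ i, n ≤ i → z i = 0) → HasSum (fun α => c α * mono z α) (F z)

/-- On the torus of radius r in the first n variables, the expansion is an absolutely convergent
Fourier series with coefficients c α · `damp n r α`. -/
theorem HasExpansion.integral {F : CZero → ℂ} {n : ℕ} {c : (ℕ →₀ ℕ) → ℂ} (h : HasExpansion F n c)
    {r : ℝ} (h0 : 0 ≤ r) (h1 : r < 1) :
    (∀ α, ∫ w, F (scaled n r w) * torusMonomial (-toIntIndex α) w ∂torusMeasure =
      c α * damp n r α) ∧
      ∀ β : ℕ →₀ ℤ, (∀ α, toIntIndex α ≠ β) →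
        ∫ w, F (scaled n r w) * torusMonomial (-β) w ∂torusMeasure = 0 := by
  have hs : ∀ w, HasSum (fun α => c α * damp n r α * torusMonomial (toIntIndex α) w)
      (F (scaled n r w)) := fun w => by
    have := h _ (scaled_mem_ball h0 h1 w) fun i hi => scaled_apply_eq_zero hi
    simpa only [mono_scaled, mul_assoc] using this
  refine integral_of_hasSum_mono ?_ hs
  -- Summability in ℂ is absolute and monomials have modulus 1 on the torus, so convergence at a
  -- single point suffices.
  have := (hs 1).summable.norm
  simpa [norm_torusMonomial] using this

/-- Both families give the same Fourier coefficients on the torus of radius 1/2, where the damping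
factor (1/2)^{|α|} is nonzero for α supported in the first n variables. -/
theorem HasExpansion.coeff_unique {F : CZero → ℂ} {n : ℕ} {c c' : (ℕ →₀ ℕ) → ℂ}
    (h : HasExpansion F n c) (h' : HasExpansion F n c') {α : ℕ →₀ ℕ} (hα : ∀ i, n ≤ i → α i = 0) :
    c α = c' α := by
  have h1 := (h.integral (r := 1 / 2) (by norm_num) (by norm_num)).1 α
  rw [(h'.integral (r := 1 / 2) (by norm_num) (by norm_num)).1 α, damp_eq hα] at h1
  exact (mul_right_cancel₀ (pow_ne_zero _ (by norm_num)) h1).symm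

theorem exists_support_bound (α : ℕ →₀ ℕ) : ∃ n, ∀ i, n ≤ i → α i = 0 := by
  refine ⟨α.support.sup id + 1, fun i hi => ?_⟩
  by_contra h
  have := Finset.le_sup (f := id) (Finsupp.mem_support_iff.2 h)
  simp only [id] at this
  omega

theorem isMonomialCoeff_iff {g : HInfBall} {G : CZero → ℂ}
    (hG : ∀ x : CZeroBall, G x = (g : CZeroBall →ᵇ ℂ) x) {c : (ℕ →₀ ℕ) → ℂ} :
    IsMonomialCoeff g c ↔ ∀ n, HasExpansion G n c := by
  refine forall_congr' fun n => ⟨fun h z hz hz0 => ?_, fun h z hz0 => ?_⟩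
  · rw [hG ⟨z, hz⟩]
    exact h ⟨z, hz⟩ hz0
  · rw [← hG]
    exact h z z.2 hz0

theorem IsMonomialCoeff.unique {g : HInfBall} {c c' : (ℕ →₀ ℕ) → ℂ} (h : IsMonomialCoeff g c)
    (h' : IsMonomialCoeff g c') : c = c' := by
  obtain ⟨G, -, hG⟩ := g.2
  funext α
  obtain ⟨n, hn⟩ := exists_support_bound α
  exact ((isMonomialCoeff_iff hG).1 h n).coeff_unique ((isMonomialCoeff_iff hG).1 h' n) hn

/-- The expansions in n variables are glued: c α is read off with enough variables N α to contain
its support. It agrees with the n-variable coefficient by uniqueness in the first min(n, N α)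
variables. -/
theorem exists_isMonomialCoeff (g : HInfBall) : ∃ c, IsMonomialCoeff g c := by
  obtain ⟨G, hGd, hG⟩ := g.2
  have hGM : ∀ x ∈ Metric.ball (0 : CZero) 1, ‖G x‖ ≤ ‖(g : CZeroBall →ᵇ ℂ)‖ := fun x hx => by
    rw [hG ⟨x, hx⟩]; exact BoundedContinuousFunction.norm_coe_le_norm _ _
  choose c _ _ hc using fun n => exists_expansion n G hGd hGM
  choose N hN using exists_support_bound
  refine ⟨fun α => c (N α) α, (isMonomialCoeff_iff hG).2 fun n z hz hz0 => ?_⟩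
  refine (hc n z hz hz0).congr_fun fun α => ?_
  by_cases hα : ∃ i, n ≤ i ∧ α i ≠ 0
  · obtain ⟨i, hi, hαi⟩ := hα
    rw [mono_eq_zero hαi (hz0 i hi), mul_zero, mul_zero]
  · push Not at hα
    congr 1
    have h1 : HasExpansion G (min n (N α)) (c n) := fun z hz h =>
      hc n z hz fun i hi => h i (min_le_of_left_le hi)
    have h2 : HasExpansion G (min n (N α)) (c (N α)) := fun z hz h =>
      hc (N α) z hz fun i hi => h i (min_le_of_right_le hi)
    refine h2.coeff_unique h1 fun i hi => ?_
    rcases min_le_iff.1 hi with h | h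
    · exact hα i h
    · exact hN α i h

/-! ### Boundary functions by L²-convergence -/

theorem norm_sq_lp_two {ι : Type*} (x : lp (fun _ : ι => ℂ) 2) : ‖x‖ ^ 2 = ∑' i, ‖x i‖ ^ 2 := by
  have h := lp.norm_rpow_eq_tsum (p := 2) (by norm_num) x
  simpa using h

/-- Bounded functions with convergent Fourier coefficients of the prescribed form converge to a
bounded function with the limit coefficients. -/
theorem exists_bounded_of_damped {c : (ℕ →₀ ℕ) → ℂ} {M : ℝ} {t : ℕ → (ℕ →₀ ℕ) → ℂ}
    (ht1 : ∀ j α, ‖t j α‖ ≤ 1) (htlim : ∀ α, Tendsto (fun j => t j α) atTop (𝓝 1))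
    {f : ℕ → Torus → ℂ} (hf : ∀ j, AEStronglyMeasurable (f j) torusMeasure)
    (hfM : ∀ j w, ‖f j w‖ ≤ M)
    (hcoeff : ∀ j α, ∫ w, f j w * torusMonomial (-toIntIndex α) w ∂torusMeasure = c α * t j α)
    (hcoeff' : ∀ j, ∀ β : ℕ →₀ ℤ, (∀ α, toIntIndex α ≠ β) →
      ∫ w, f j w * torusMonomial (-β) w ∂torusMeasure = 0) :
    ∃ g : HInfTorus, ‖g‖ ≤ M ∧ hardyCoeff g = c := by
  have hM0 : 0 ≤ M := (norm_nonneg _).trans (hfM 0 1)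
  have hmem : ∀ j, MemLp (f j) 2 torusMeasure := fun j =>
    MemLp.of_bound (hf j) M (Eventually.of_forall (hfM j))
  set u : ℕ → Lp ℂ 2 torusMeasure := fun j => (hmem j).toLp (f j) with hu
  have hrepr : ∀ j β, torusBasis.repr (u j) β = ∫ w, f j w * torusMonomial (-β) w ∂torusMeasure := by
    intro j β
    rw [torusBasis_repr]
    refine integral_congr_ae ?_
    filter_upwards [(hmem j).coeFn_toLp] with w hw
    rw [hu, hw]
  have hunorm : ∀ j, ‖u j‖ ≤ M := fun j => by
    refine (Lp.norm_le_of_ae_bound hM0 ?_).trans_eq (by simp [measureUnivNNReal] : _ = M)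
    filter_upwards [(hmem j).coeFn_toLp] with w hw
    rw [hw]; exact hfM j w
  -- Bessel's inequality for each f j on a finite set of indices; j → ∞ removes the damping and
  -- yields c ∈ ℓ².
  have hbessel : ∀ S : Finset (ℕ →₀ ℕ), ∑ α ∈ S, ‖c α‖ ^ 2 ≤ M ^ 2 := by
    intro S
    have h1 : ∀ j, ∑ α ∈ S, ‖c α * t j α‖ ^ 2 ≤ M ^ 2 := fun j => by
      have h2 := (orthonormal_torusMonomialLp.comp _ toIntIndex_injective).sum_inner_products_le
        (u j) (s := S)
      refine le_trans (le_of_eq (Finset.sum_congr rfl fun α _ => ?_))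
        (h2.trans (pow_le_pow_left₀ (norm_nonneg _) (hunorm j) 2))
      rw [Function.comp_apply, inner_torusMonomialLp, ← torusBasis_repr, hrepr, hcoeff]
    have h3 : Tendsto (fun j => ∑ α ∈ S, ‖c α * t j α‖ ^ 2) atTop (𝓝 (∑ α ∈ S, ‖c α‖ ^ 2)) := by
      refine tendsto_finsetSum _ fun α _ => ?_
      have := (((htlim α).const_mul (c α)).norm.pow 2)
      rwa [mul_one] at this
    exact le_of_tendsto h3 (Eventually.of_forall h1)
  have hcs : Summable fun α => ‖c α‖ ^ 2 := summable_of_sum_le (fun _ => by positivity) hbessel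
  set y : (ℕ →₀ ℤ) → ℂ := Function.extend toIntIndex c 0 with hy
  have hyα : ∀ α, y (toIntIndex α) = c α := fun α => toIntIndex_injective.extend_apply _ _ _
  have hy0 : ∀ β, (∀ α, toIntIndex α ≠ β) → y β = 0 := fun β hβ =>
    Function.extend_apply' _ _ _ fun ⟨α, h⟩ => hβ α h
  have hymem : Memℓp y 2 := by
    rw [memℓp_gen_iff (by norm_num)]
    refine (toIntIndex_injective.summable_iff fun β hβ => ?_).1 ?_
    · rw [hy0 β fun α h => hβ ⟨α, h⟩]; simp
    · refine hcs.congr fun α => ?_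
      simp [hyα]
  set v : Lp ℂ 2 torusMeasure := torusBasis.repr.symm ⟨y, hymem⟩ with hv
  have hvrepr : ∀ β, torusBasis.repr v β = y β := fun β => by
    rw [hv, LinearIsometryEquiv.apply_symm_apply]
  -- Parseval; since |t j α - 1| ≤ 2, dominated convergence sends this sum to 0.
  have hdist : ∀ j, ‖u j - v‖ ^ 2 = ∑' α, ‖c α‖ ^ 2 * ‖t j α - 1‖ ^ 2 := by
    intro j
    rw [← torusBasis.repr.norm_map, norm_sq_lp_two, ← toIntIndex_injective.tsum_eq]
    · refine tsum_congr fun α => ?_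
      rw [map_sub, lp.coeFn_sub, Pi.sub_apply, hvrepr, hyα, hrepr, hcoeff, ← mul_pow, ← norm_mul]
      congr 2; ring
    · intro β hβ
      by_contra hcon
      have hne : ∀ α, toIntIndex α ≠ β := fun α h => hcon ⟨α, h⟩
      refine hβ ?_
      simp only
      rw [map_sub, lp.coeFn_sub, Pi.sub_apply, hvrepr, hy0 β hne, hrepr, hcoeff' j β hne]
      simp
  have hlim : Tendsto (fun j => ‖u j - v‖ ^ 2) atTop (𝓝 0) := by
    simp_rw [hdist]
    have h1 := tendsto_tsum_of_dominated_convergence (𝓕 := atTop)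
      (f := fun j α => ‖c α‖ ^ 2 * ‖t j α - 1‖ ^ 2) (g := fun _ => (0 : ℝ))
      (bound := fun α => ‖c α‖ ^ 2 * 2 ^ 2) (hcs.mul_right _) (fun α => ?_)
      (Eventually.of_forall fun j α => ?_)
    · simpa using h1
    · have := (((htlim α).sub_const 1).norm.pow 2).const_mul (‖c α‖ ^ 2)
      simpa using this
    · rw [Real.norm_of_nonneg (by positivity)]
      gcongr
      calc ‖t j α - 1‖ ≤ ‖t j α‖ + ‖(1 : ℂ)‖ := norm_sub_le _ _
        _ ≤ 2 := by rw [norm_one]; linarith [ht1 j α]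
  have hlim' : Tendsto u atTop (𝓝 v) := by
    rw [tendsto_iff_norm_sub_tendsto_zero]
    have := (Real.continuous_sqrt.tendsto 0).comp hlim
    simpa [Function.comp_def, Real.sqrt_sq (norm_nonneg _)] using this
  -- The L²-limit has the right coefficients; an a.e. convergent subsequence transfers the uniform
  -- bound M to it.
  obtain ⟨ns, -, hns⟩ := (tendstoInMeasure_of_tendsto_Lp hlim').exists_seq_tendsto_ae
  have hvM : ∀ᵐ w ∂torusMeasure, ‖v w‖ ≤ M := by
    have hall : ∀ᵐ w ∂torusMeasure, ∀ j, u j w = f j w := ae_all_iff.2 fun j => (hmem j).coeFn_toLp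
    filter_upwards [hns, hall] with w hw hw2
    refine le_of_tendsto hw.norm (Eventually.of_forall fun i => ?_)
    rw [hw2]; exact hfM _ w
  have hvtop : MemLp v ∞ torusMeasure := memLp_top_of_bound (Lp.aestronglyMeasurable v) M hvM
  set g : LInfTorus := hvtop.toLp v with hg
  have hgv : g =ᵐ[torusMeasure] v := hvtop.coeFn_toLp
  have hgc : ∀ β, fourierCoeff g β = y β := fun β => by
    rw [← hvrepr, torusBasis_repr, fourierCoeff]
    refine integral_congr_ae ?_
    filter_upwards [hgv] with w hw
    rw [hw]
  refine ⟨⟨g, fun β hβ => ?_⟩, ?_, funext fun α => ?_⟩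
  · rw [hgc, hy0]
    rintro α rfl
    exact hβ fun i => by rw [toIntIndex_apply]; positivity
  · refine LInfTorus.norm_le hM0 ?_
    filter_upwards [hgv, hvM] with w hw hw2
    change ‖g w‖ ≤ M
    rw [hw]; exact hw2
  · rw [hardyCoeff, hgc, hyα]

/-- Every bounded holomorphic function on the ball comes from a function in `H_∞(𝕋^∞)`. -/
theorem exists_hardy_of_holomorphic (g : HInfBall) :
    ∃ f : HInfTorus, ‖f‖ ≤ ‖g‖ ∧ IsMonomialCoeff g (hardyCoeff f) := by
  obtain ⟨c, hc⟩ := exists_isMonomialCoeff g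
  obtain ⟨G, hGd, hG⟩ := g.2
  have hGM : ∀ x ∈ Metric.ball (0 : CZero) 1, ‖G x‖ ≤ ‖(g : CZeroBall →ᵇ ℂ)‖ := fun x hx => by
    rw [hG ⟨x, hx⟩]; exact BoundedContinuousFunction.norm_coe_le_norm _ _
  -- Radii below 1 tending to 1, coupled with truncation to j variables, so that each damping factor
  -- tends to 1.
  set r : ℕ → ℝ := fun j => 1 - 1 / (j + 1) with hr
  have hr0 : ∀ j, 0 ≤ r j := fun j => by
    rw [hr, sub_nonneg]
    exact div_le_one_of_le₀ (by linarith [(Nat.cast_nonneg j : (0 : ℝ) ≤ j)]) (by positivity)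
  have hr1 : ∀ j, r j < 1 := fun j => by
    have : (0 : ℝ) < 1 / (j + 1) := by positivity
    rw [hr]; linarith
  have hrlim : Tendsto r atTop (𝓝 1) := by
    simpa [hr] using tendsto_one_div_add_atTop_nhds_zero_nat.const_sub (1 : ℝ)
  have hexp := (isMonomialCoeff_iff hG).1 hc
  obtain ⟨f, hfM, hfc⟩ := exists_bounded_of_damped (c := c) (M := ‖(g : CZeroBall →ᵇ ℂ)‖)
    (t := fun j => damp j (r j)) (f := fun j w => G (scaled j (r j) w))
    (fun j α => norm_damp_le_one (hr0 j) (hr1 j).le α)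
    (fun α => by
      obtain ⟨n, hn⟩ := exists_support_bound α
      have h1 : Tendsto (fun j => ((r j : ℝ) : ℂ) ^ α.degree) atTop (𝓝 (((1 : ℝ) : ℂ) ^ α.degree)) :=
        ((Complex.continuous_ofReal.tendsto 1).comp hrlim).pow _
      rw [Complex.ofReal_one, one_pow] at h1
      refine h1.congr' ?_
      filter_upwards [eventually_ge_atTop n] with j hj
      rw [damp_eq fun i hi => hn i (hj.trans hi)])
    (fun j => (hGd.continuousOn.comp_continuous (continuous_scaled j (r j))
      fun w => scaled_mem_ball (hr0 j) (hr1 j) w).aestronglyMeasurable)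
    (fun j w => hGM _ (scaled_mem_ball (hr0 j) (hr1 j) w))
    (fun j => ((hexp j).integral (hr0 j) (hr1 j)).1)
    (fun j => ((hexp j).integral (hr0 j) (hr1 j)).2)
  exact ⟨f, hfM, hfc ▸ hc⟩

/-- The correspondence between `H_∞(𝕋^∞)` and `H_∞(𝔻₀^∞)` respects the coefficients. -/
theorem exists_linearIsometryEquiv :
    ∃ φ : HInfTorus ≃ₗᵢ[ℂ] HInfBall, ∀ f, IsMonomialCoeff (φ f) (hardyCoeff f) := by
  choose Φ hΦ hΦc using exists_holomorphic_of_hardy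
  have hadd : ∀ f g, Φ (f + g) = Φ f + Φ g := fun f g => by
    refine (hΦc (f + g)).eq fun k z hz => ?_
    refine ((hΦc f k z hz).add (hΦc g k z hz)).congr_fun fun α => ?_
    rw [← add_mul]
    congr 1
    exact fourierCoeff_add _ _ _
  have hsmul : ∀ (c : ℂ) f, Φ (c • f) = c • Φ f := fun c f => by
    refine (hΦc (c • f)).eq fun k z hz => ?_
    refine ((hΦc f k z hz).mul_left c).congr_fun fun α => ?_
    rw [← mul_assoc]
    congr 1
    exact fourierCoeff_smul _ _ _
  have hinv : ∀ g, ∃ f, ‖f‖ ≤ ‖g‖ ∧ Φ f = g := fun g => by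
    obtain ⟨f, hf, hfc⟩ := exists_hardy_of_holomorphic g
    exact ⟨f, hf, (hΦc f).eq hfc⟩
  have hinj : Function.Injective Φ := fun f g h => by
    refine HInfTorus.ext_hardyCoeff fun α => ?_
    have h1 := hΦc f
    rw [h] at h1
    exact congr_fun (h1.unique (hΦc g)) α
  -- The preimage of Φ f with norm at most ‖Φ f‖ is f itself by injectivity, so two contractions
  -- make an isometry.
  have hnorm : ∀ f, ‖Φ f‖ = ‖f‖ := fun f => by
    refine le_antisymm (hΦ f) ?_
    obtain ⟨f', hf', h⟩ := hinv (Φ f)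
    rwa [hinj h] at hf'
  let L : HInfTorus →ₗᵢ[ℂ] HInfBall :=
    ⟨{ toFun := Φ, map_add' := hadd, map_smul' := hsmul }, hnorm⟩
  exact ⟨LinearIsometryEquiv.ofSurjective L fun g => (hinv g).imp fun f h => h.2, hΦc⟩

end Boundary

/-! ### The Arens extension -/

section Arens

/-- The functional is tested on the truncated sequence of conjugate phases of φ(e_i), which has norm
at most 1; where φ(e_i) = 0 the phase 0/0 = 0 is harmless. -/
theorem sum_norm_unitVec_le (φ : CZero →L[ℂ] ℂ) (n : ℕ) :
    ∑ i ∈ Finset.range n, ‖φ (unitVec i)‖ ≤ ‖φ‖ := by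
  set s : ℕ → ℂ := fun i => starRingEnd ℂ (φ (unitVec i)) / ‖φ (unitVec i)‖ with hs
  have hs1 : ∀ i, ‖s i‖ ≤ 1 := fun i => by
    simp only [hs, norm_div, RCLike.norm_conj, Complex.norm_real, norm_norm]
    exact div_self_le_one _
  have hφ : φ (cut n s) = ((∑ i ∈ Finset.range n, ‖φ (unitVec i)‖ : ℝ) : ℂ) := by
    rw [cut_eq_sum, map_sum, Complex.ofReal_sum]
    refine Finset.sum_congr rfl fun i _ => ?_
    rw [map_smul, smul_eq_mul]
    by_cases h : φ (unitVec i) = 0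
    · simp [h]
    · have h' : ((‖φ (unitVec i)‖ : ℝ) : ℂ) ≠ 0 := by simpa using h
      simp only [hs]
      rw [div_mul_eq_mul_div, mul_comm, Complex.mul_conj, Complex.normSq_eq_norm_sq,
        Complex.ofReal_pow]
      field_simp
  have h1 := φ.le_opNorm_of_le (norm_cut_le (n := n) zero_le_one fun i _ => hs1 i)
  rw [hφ, Complex.norm_of_nonneg (Finset.sum_nonneg fun _ _ => norm_nonneg _), mul_one] at h1
  exact h1

theorem summable_norm_unitVec (φ : CZero →L[ℂ] ℂ) : Summable fun i => ‖φ (unitVec i)‖ :=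
  summable_of_sum_range_le (fun _ => norm_nonneg _) (sum_norm_unitVec_le φ)

theorem tsum_norm_unitVec_le (φ : CZero →L[ℂ] ℂ) : ∑' i, ‖φ (unitVec i)‖ ≤ ‖φ‖ :=
  Real.tsum_le_of_sum_range_le (fun _ => norm_nonneg _) (sum_norm_unitVec_le φ)

/-- The element of `ℓ₁` representing a functional on `c₀`. -/
noncomputable def dualSeq (φ : CZero →L[ℂ] ℂ) : EllOne :=
  ⟨fun i => φ (unitVec i), (memℓp_gen_iff (p := 1) (by norm_num)).2
    (by simpa using summable_norm_unitVec φ)⟩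

theorem dualSeq_apply (φ : CZero →L[ℂ] ℂ) (i : ℕ) : dualSeq φ i = φ (unitVec i) := rfl

theorem EllInf.norm_apply_le (y : EllInf) (i : ℕ) : ‖y i‖ ≤ ‖y‖ :=
  lp.norm_apply_le_norm (by simp) y i

theorem hasSum_bidual (φ : CZero →L[ℂ] ℂ) (y : EllInf) :
    HasSum (fun i => y i * dualSeq φ i) (∑' i, y i * dualSeq φ i) := by
  refine (Summable.of_norm_bounded ((summable_norm_unitVec φ).mul_left ‖y‖) fun i => ?_).hasSum
  rw [norm_mul]
  gcongr
  · exact EllInf.norm_apply_le y i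
  · exact le_rfl

/-- The canonical embedding `c₀' = ℓ₁ → ℓ_∞'`. -/
noncomputable def bidual : (CZero →L[ℂ] ℂ) →L[ℂ] (EllInf →L[ℂ] ℂ) :=
  LinearMap.mkContinuous₂
    (LinearMap.mk₂ ℂ (fun φ y => ∑' i, (y : EllInf) i * dualSeq φ i)
      (fun φ ψ y => by
        rw [← ((hasSum_bidual φ y).add (hasSum_bidual ψ y)).tsum_eq]
        refine tsum_congr fun i => ?_
        simp only [dualSeq_apply, add_apply, mul_add])
      (fun c φ y => by
        rw [smul_eq_mul, ← ((hasSum_bidual φ y).mul_left c).tsum_eq]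
        refine tsum_congr fun i => ?_
        simp only [dualSeq_apply, smul_apply, smul_eq_mul]; ring)
      (fun φ y y' => by
        rw [← ((hasSum_bidual φ y).add (hasSum_bidual φ y')).tsum_eq]
        refine tsum_congr fun i => ?_
        rw [lp.coeFn_add, Pi.add_apply, add_mul])
      (fun c φ y => by
        rw [smul_eq_mul, ← ((hasSum_bidual φ y).mul_left c).tsum_eq]
        refine tsum_congr fun i => ?_
        rw [lp.coeFn_smul, Pi.smul_apply, smul_eq_mul, mul_assoc])) 1
    fun φ y => by
      rw [LinearMap.mk₂_apply, one_mul, mul_comm]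
      refine (tsum_of_norm_bounded ((summable_norm_unitVec φ).hasSum.mul_left ‖y‖) fun i => ?_).trans
        (by gcongr; exact tsum_norm_unitVec_le φ)
      rw [norm_mul, dualSeq_apply]
      gcongr
      exact EllInf.norm_apply_le y i

theorem hasSum_bidual_apply (φ : CZero →L[ℂ] ℂ) (y : EllInf) :
    HasSum (fun i => y i * φ (unitVec i)) (bidual φ y) := hasSum_bidual φ y

theorem sum_range_eq_apply_cut (φ : CZero →L[ℂ] ℂ) (u : ℕ → ℂ) (n : ℕ) :
    ∑ i ∈ Finset.range n, u i * φ (unitVec i) = φ (cut n u) := by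
  rw [cut_eq_sum, map_sum]
  simp

theorem bidual_toEllInf (φ : CZero →L[ℂ] ℂ) (x : CZero) : bidual φ (CZero.toEllInf x) = φ x := by
  refine tendsto_nhds_unique (hasSum_bidual_apply φ (CZero.toEllInf x)).tendsto_sum_nat ?_
  refine ((φ.continuous.tendsto x).comp (tendsto_cut x)).congr fun n => ?_
  rw [sum_range_eq_apply_cut]
  rfl

/-- The value is the pairing with the ℓ₁ sequence of φ, one of the coordinates that induce the weak*
topology. -/
theorem continuous_bidual (φ : CZero →L[ℂ] ℂ) :
    @Continuous EllInf ℂ weakStarTopology inferInstance fun y => bidual φ y :=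
  @Continuous.comp EllInf (EllOne → ℂ) ℂ weakStarTopology _ _ _ _
    (continuous_apply (dualSeq φ)) continuous_induced_dom

/-- Bounded multilinear forms on `c₀`. -/
abbrev FormC (m : ℕ) : Type := ContinuousMultilinearMap ℂ (fun _ : Fin m => CZero) ℂ

/-- Bounded multilinear forms on `ℓ_∞`. -/
abbrev FormE (m : ℕ) : Type := ContinuousMultilinearMap ℂ (fun _ : Fin m => EllInf) ℂ

/-- The extension of multilinear forms, one variable after the other, that is induced by an
extension operator `J` for functionals. -/
noncomputable def extendForms {E F : Type*} [NormedAddCommGroup E] [NormedSpace ℂ E]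
    [NormedAddCommGroup F] [NormedSpace ℂ F] (J : (E →L[ℂ] ℂ) →L[ℂ] (F →L[ℂ] ℂ)) : (m : ℕ) →
      ContinuousMultilinearMap ℂ (fun _ : Fin m => E) ℂ →L[ℂ]
        ContinuousMultilinearMap ℂ (fun _ : Fin m => F) ℂ
  | 0 =>
    ((continuousMultilinearCurryFin0 ℂ F ℂ).symm.toContinuousLinearEquiv : ℂ →L[ℂ] _) ∘L
      ((continuousMultilinearCurryFin0 ℂ E ℂ).toContinuousLinearEquiv : _ →L[ℂ] ℂ)
  -- The composition reads from the bottom up: curry the first variable, extend the other m, regard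
  -- the result as a form with values in E', apply J, and undo the two rearrangements.
  | m + 1 =>
    ((continuousMultilinearCurryLeftEquiv ℂ (fun _ : Fin (m + 1) => F)
        ℂ).symm.toContinuousLinearEquiv :
          (F →L[ℂ] ContinuousMultilinearMap ℂ (fun _ : Fin m => F) ℂ) →L[ℂ] _) ∘L
      ((ContinuousLinearMap.flipMultilinearEquiv ℂ (fun _ : Fin m => F) F ℂ).symm :
        _ →L[ℂ] (F →L[ℂ] ContinuousMultilinearMap ℂ (fun _ : Fin m => F) ℂ)) ∘L
      (ContinuousLinearMap.compContinuousMultilinearMapL ℂ (fun _ : Fin m => F)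
        (E →L[ℂ] ℂ) (F →L[ℂ] ℂ) J) ∘L
      ((ContinuousLinearMap.flipMultilinearEquiv ℂ (fun _ : Fin m => F) E ℂ) :
        (E →L[ℂ] ContinuousMultilinearMap ℂ (fun _ : Fin m => F) ℂ) →L[ℂ] _) ∘L
      (ContinuousLinearMap.compL ℂ E _ _ (extendForms J m)) ∘L
      ((continuousMultilinearCurryLeftEquiv ℂ (fun _ : Fin (m + 1) => E)
        ℂ).toContinuousLinearEquiv :
          _ →L[ℂ] (E →L[ℂ] ContinuousMultilinearMap ℂ (fun _ : Fin m => E) ℂ))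

/-- The Arens extension of multilinear forms. -/
noncomputable def arens (m : ℕ) : FormC m →L[ℂ] FormE m := extendForms bidual m

/-- The functional `x ↦ Ã(x, v_1, …, v_m)` on `c₀`. -/
noncomputable def arensSlice {m : ℕ} (A : FormC (m + 1)) (v : Fin m → EllInf) : CZero →L[ℂ] ℂ :=
  (ContinuousMultilinearMap.apply ℂ (fun _ : Fin m => EllInf) ℂ v) ∘L (arens m) ∘L A.curryLeft

theorem arensSlice_apply {m : ℕ} (A : FormC (m + 1)) (v : Fin m → EllInf) (x : CZero) :
    arensSlice A v x = arens m (A.curryLeft x) v := rfl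

theorem arens_zero_apply (A : FormC 0) (z : Fin 0 → EllInf) : arens 0 A z = A 0 := rfl

theorem arens_succ_apply {m : ℕ} (A : FormC (m + 1)) (z : Fin (m + 1) → EllInf) :
    arens (m + 1) A z = bidual (arensSlice A fun i => z i.succ) (z 0) := rfl

/-- In the first variable the extension is `bidual` of a fixed functional, hence weak*-continuous
whatever the later arguments. For a later variable the first argument lies in c₀, where `bidual` is
evaluation, and the claim reduces to a form with one variable fewer. -/
theorem isArensExtension_arens {m : ℕ} (A : FormC m) : IsArensExtension A (arens m A) := by
  induction m with
  | zero =>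
    refine ⟨fun x => ?_, fun j => j.elim0⟩
    rw [arens_zero_apply]
    congr 1
    exact Subsingleton.elim _ _
  | succ m ih =>
    refine ⟨fun x => ?_, fun j x z => ?_⟩
    · rw [arens_succ_apply, bidual_toEllInf, arensSlice_apply, (ih _).extends_form,
        ContinuousMultilinearMap.curryLeft_apply]
      congr 1
      exact Fin.cons_self_tail x
    · simp only [arens_succ_apply]
      refine Fin.cases ?_ (fun j => ?_) j
      · simp only [Fin.not_lt_zero, if_false, if_true, Fin.succ_ne_zero]
        exact continuous_bidual _
      · have h0 : (0 : Fin (m + 1)) < j.succ := Fin.succ_pos j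
        simp only [h0, if_true, bidual_toEllInf, arensSlice_apply, Fin.succ_lt_succ_iff,
          Fin.succ_inj]
        exact (ih (A.curryLeft (x 0))).weakStar_continuous j (fun i => x i.succ) fun i => z i.succ

end Arens

/-! ### The Aron–Berner extension on the polytorus -/

section AronBerner

/-- The Aron–Berner extension of the polynomial of `A`, restricted to `𝕋^∞`. -/
noncomputable def arensDiag {m : ℕ} (A : FormC m) (w : Torus) : ℂ :=
  arens m A fun _ => Torus.toEllInf w

theorem Torus.norm_toEllInf_le (w : Torus) : ‖Torus.toEllInf w‖ ≤ 1 :=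
  lp.norm_le_of_forall_le zero_le_one fun i => (Circle.norm_coe (w i)).le

theorem exists_extendForms_bound {E F : Type*} [NormedAddCommGroup E] [NormedSpace ℂ E]
    [NormedAddCommGroup F] [NormedSpace ℂ F] (J : (E →L[ℂ] ℂ) →L[ℂ] (F →L[ℂ] ℂ)) (m : ℕ) :
    ∃ C : ℝ, 0 ≤ C ∧ ∀ (A : ContinuousMultilinearMap ℂ (fun _ : Fin m => E) ℂ) (v : Fin m → F),
      (∀ i, ‖v i‖ ≤ 1) → ‖extendForms J m A v‖ ≤ C * ‖A‖ := by
  obtain ⟨C, hC0, hC⟩ := (extendForms J m).bound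
  refine ⟨C, hC0.le, fun A v hv => ?_⟩
  refine ((extendForms J m A).le_opNorm _).trans ?_
  refine (mul_le_of_le_one_right (norm_nonneg _) ?_).trans (hC A)
  exact Finset.prod_le_one (fun _ _ => norm_nonneg _) fun i _ => hv i

theorem norm_curryLeft_apply_le {E : Type*} [NormedAddCommGroup E] [NormedSpace ℂ E] {m : ℕ}
    (A : ContinuousMultilinearMap ℂ (fun _ : Fin (m + 1) => E) ℂ) (x : E) (hx : ‖x‖ ≤ 1) :
    ‖A.curryLeft x‖ ≤ ‖A‖ := by
  refine (A.curryLeft.le_opNorm_of_le hx).trans_eq ?_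
  rw [mul_one, ContinuousMultilinearMap.curryLeft_norm]

theorem exists_arensDiag_bound (m : ℕ) :
    ∃ C : ℝ, 0 ≤ C ∧ ∀ (A : FormC m) (w : Torus), ‖arensDiag A w‖ ≤ C * ‖A‖ := by
  obtain ⟨C, hC0, hC⟩ := exists_extendForms_bound bidual m
  exact ⟨C, hC0, fun A w => hC A _ fun _ => Torus.norm_toEllInf_le w⟩

/-- The recursion behind measurability, Fourier coefficients and expansion alike: the first variable
is expanded along the unit vectors. -/
theorem hasSum_arensDiag {m : ℕ} (A : FormC (m + 1)) (w : Torus) :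
    HasSum (fun i => (w i : ℂ) * arensDiag (A.curryLeft (unitVec i)) w) (arensDiag A w) :=
  hasSum_bidual_apply (arensSlice A fun _ => Torus.toEllInf w) (Torus.toEllInf w)

/-- A partial sum is the extension with its first variable frozen at a truncation of w, of norm at
most 1. The uniform bound is the majorant for dominated convergence. -/
theorem exists_norm_sum_arensDiag_le {m : ℕ} (A : FormC (m + 1)) : ∃ C : ℝ, ∀ (w : Torus) (n : ℕ),
    ‖∑ i ∈ Finset.range n, (w i : ℂ) * arensDiag (A.curryLeft (unitVec i)) w‖ ≤ C := by
  obtain ⟨C, hC0, hC⟩ := exists_arensDiag_bound m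
  refine ⟨C * ‖A‖, fun w n => ?_⟩
  have h := sum_range_eq_apply_cut (arensSlice A fun _ => Torus.toEllInf w) (fun i => (w i : ℂ)) n
  have h1 : ∑ i ∈ Finset.range n, (w i : ℂ) * arensDiag (A.curryLeft (unitVec i)) w =
      arensDiag (A.curryLeft (cut n fun i => (w i : ℂ))) w := h
  rw [h1]
  refine (hC _ w).trans (mul_le_mul_of_nonneg_left ?_ hC0)
  exact norm_curryLeft_apply_le A _
    (norm_cut_le zero_le_one fun i _ => (Circle.norm_coe (w i)).le)

theorem measurable_circle_coe (i : ℕ) : Measurable fun w : Torus => (w i : ℂ) :=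
  (continuous_subtype_val.comp (continuous_apply i)).measurable

theorem measurable_arensDiag {m : ℕ} (A : FormC m) : Measurable (arensDiag A) := by
  induction m with
  | zero => exact measurable_const
  | succ m ih =>
    refine measurable_of_tendsto_metrizable
      (f := fun n w => ∑ i ∈ Finset.range n, (w i : ℂ) * arensDiag (A.curryLeft (unitVec i)) w)
      (fun n => Finset.measurable_fun_sum _ fun i _ => (measurable_circle_coe i).mul (ih _))
      (tendsto_pi_nhds.2 fun w => (hasSum_arensDiag A w).tendsto_sum_nat)

/-- The Fourier coefficients of the Aron–Berner extension. -/
noncomputable def arensCoeff {m : ℕ} (A : FormC m) (α : ℕ →₀ ℤ) : ℂ :=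
  ∫ w, arensDiag A w * torusMonomial (-α) w ∂torusMeasure

theorem integrable_arensDiag_mul {m : ℕ} (A : FormC m) (α : ℕ →₀ ℤ) :
    Integrable (fun w => arensDiag A w * torusMonomial α w) torusMeasure := by
  obtain ⟨C, -, hC⟩ := exists_arensDiag_bound m
  exact Integrable.of_bound
    ((measurable_arensDiag A).mul (measurable_torusMonomial α)).aestronglyMeasurable
    (C * ‖A‖) (Eventually.of_forall fun w => by
      rw [norm_mul, norm_torusMonomial, mul_one]; exact hC A w)

/-- The recursion integrated termwise; the factor w_i lowers the index by the i-th unit vector. -/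
theorem tendsto_arensCoeff {m : ℕ} (A : FormC (m + 1)) (α : ℕ →₀ ℤ) :
    Tendsto (fun n => ∑ i ∈ Finset.range n,
      arensCoeff (A.curryLeft (unitVec i)) (α - Finsupp.single i 1)) atTop (𝓝 (arensCoeff A α)) := by
  have hterm : ∀ i w, (w i : ℂ) * arensDiag (A.curryLeft (unitVec i)) w * torusMonomial (-α) w =
      arensDiag (A.curryLeft (unitVec i)) w * torusMonomial (-(α - Finsupp.single i 1)) w := by
    intro i w
    rw [neg_sub, sub_eq_add_neg, torusMonomial_add, torusMonomial_single, zpow_one]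
    ring
  obtain ⟨C, hC⟩ := exists_norm_sum_arensDiag_le A
  have h := tendsto_integral_of_dominated_convergence (μ := torusMeasure)
    (F := fun n w => (∑ i ∈ Finset.range n, (w i : ℂ) * arensDiag (A.curryLeft (unitVec i)) w) *
      torusMonomial (-α) w) (f := fun w => arensDiag A w * torusMonomial (-α) w)
    (fun _ => C)
    (fun n => ((Finset.measurable_fun_sum _ fun i _ => (measurable_circle_coe i).mul
      (measurable_arensDiag _)).mul (measurable_torusMonomial _)).aestronglyMeasurable)
    (integrable_const _)
    (fun n => Eventually.of_forall fun w => by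
      rw [norm_mul, norm_torusMonomial, mul_one]; exact hC w n)
    (Eventually.of_forall fun w => (hasSum_arensDiag A w).tendsto_sum_nat.mul_const _)
  refine h.congr fun n => ?_
  simp_rw [Finset.sum_mul, hterm]
  exact integral_finsetSum _ fun i _ => integrable_arensDiag_mul _ _

/-- Lowering an index cannot repair a negative entry, so the property descends to the constant case.
-/
theorem arensCoeff_eq_zero_of_neg {m : ℕ} (A : FormC m) {α : ℕ →₀ ℤ} (hα : ¬ ∀ i, 0 ≤ α i) :
    arensCoeff A α = 0 := by
  induction m generalizing α with
  | zero =>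
    have : arensCoeff A α = A 0 * ∫ w, torusMonomial (-α) w ∂torusMeasure :=
      integral_const_mul _ _
    rw [this, integral_torusMonomial, if_neg, mul_zero]
    rw [neg_eq_zero]
    rintro rfl
    simp at hα
  | succ m ih =>
    refine tendsto_nhds_unique (tendsto_arensCoeff A α) ?_
    have : ∀ i, arensCoeff (A.curryLeft (unitVec i)) (α - Finsupp.single i 1) = 0 := fun i => by
      refine ih _ fun h => hα fun j => ?_
      have := h j
      rw [Finsupp.sub_apply, Finsupp.single_apply] at this
      split_ifs at this <;> omega
    simp [this]

/-- For i ≥ n, lowering α at i creates a negative entry, so the limit in the recursion is a finite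
sum. -/
theorem arensCoeff_succ {m : ℕ} (A : FormC (m + 1)) {α : ℕ →₀ ℕ} {n : ℕ}
    (hα : ∀ i, n ≤ i → α i = 0) :
    arensCoeff A (toIntIndex α) = ∑ i ∈ Finset.range n,
      arensCoeff (A.curryLeft (unitVec i)) (toIntIndex α - Finsupp.single i 1) := by
  refine tendsto_nhds_unique (tendsto_arensCoeff A _) (tendsto_const_nhds.congr' ?_)
  filter_upwards [eventually_ge_atTop n] with k hk
  refine Finset.sum_subset (Finset.range_subset_range.2 hk) fun i _ hi => ?_
  refine arensCoeff_eq_zero_of_neg _ fun h => ?_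
  have := h i
  rw [Finsupp.sub_apply, toIntIndex_apply, Finsupp.single_eq_same,
    hα i (by simpa using hi)] at this
  simp at this

theorem toIntIndex_single (i : ℕ) : toIntIndex (Finsupp.single i 1) = Finsupp.single i 1 := by
  simp [toIntIndex]

theorem arensCoeff_eq_zero_of_degree {m : ℕ} (A : FormC m) {α : ℕ →₀ ℕ} (hα : α.degree ≠ m) :
    arensCoeff A (toIntIndex α) = 0 := by
  induction m generalizing α with
  | zero =>
    have : arensCoeff A (toIntIndex α) = A 0 * ∫ w, torusMonomial (-toIntIndex α) w ∂torusMeasure :=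
      integral_const_mul _ _
    rw [this, integral_torusMonomial, if_neg, mul_zero]
    rw [neg_eq_zero]
    intro h
    refine hα ?_
    rw [toIntIndex_injective (h.trans (by simp [toIntIndex] : (0 : ℕ →₀ ℤ) = toIntIndex 0))]
    simp
  | succ m ih =>
    obtain ⟨n, hn⟩ := exists_support_bound α
    rw [arensCoeff_succ A hn]
    refine Finset.sum_eq_zero fun i _ => ?_
    by_cases hi : α i = 0
    · refine arensCoeff_eq_zero_of_neg _ fun h => ?_
      have := h i
      rw [Finsupp.sub_apply, toIntIndex_apply, Finsupp.single_eq_same, hi] at this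
      simp at this
    · obtain ⟨β, rfl⟩ : ∃ β, α = β + Finsupp.single i 1 :=
        ⟨α - Finsupp.single i 1, (tsub_add_cancel_of_le (by
          rw [Finsupp.single_le_iff]; omega)).symm⟩
      rw [toIntIndex_add, toIntIndex_single, add_sub_cancel_right]
      refine ih _ fun h => hα ?_
      rw [map_add, h, Finsupp.degree_single]

/-- The monomial expansion of the polynomial of `A`. -/
theorem hasSum_arensCoeff {m : ℕ} (A : FormC m) {n : ℕ} {z : CZero} (hz : ∀ i, n ≤ i → z i = 0) :
    HasSum (fun α => arensCoeff A (toIntIndex α) * mono z α) (A fun _ => z) := by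
  classical
  induction m with
  | zero =>
    have h0 : arensCoeff A (toIntIndex 0) = A 0 := by
      have : arensCoeff A (toIntIndex 0) = A 0 * ∫ w, torusMonomial (-toIntIndex 0) w ∂torusMeasure :=
        integral_const_mul _ _
      rw [this, integral_torusMonomial, if_pos (by simp [toIntIndex]), mul_one]
    have hA : (A fun _ => z) = A 0 := congr_arg A (Subsingleton.elim _ _)
    rw [hA]
    refine (hasSum_ite_eq (0 : ℕ →₀ ℕ) (A 0)).congr_fun fun α => ?_
    split_ifs with h
    · rw [h, h0, mono_zero, mul_one]
    · rw [arensCoeff_eq_zero_of_degree A, zero_mul]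
      rwa [Ne, Finsupp.degree_eq_zero_iff]
  | succ m ih =>
    have hAz : (A fun _ => z) = ∑ i ∈ Finset.range n, z i * A.curryLeft (unitVec i) fun _ => z := by
      have h1 : (A fun _ => z) = A.curryLeft z fun _ => z := by
        rw [ContinuousMultilinearMap.curryLeft_apply]
        congr 1
        exact (Fin.cons_self_tail (fun _ : Fin (m + 1) => z)).symm
      have h2 : z = ∑ i ∈ Finset.range n, z i • unitVec i := by
        rw [← cut_eq_sum, cut_eq_self hz]
      have h3 : A.curryLeft z = ∑ i ∈ Finset.range n, z i • A.curryLeft (unitVec i) := by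
        conv_lhs => rw [h2]
        simp
      rw [h1, h3]
      simp
    rw [hAz]
    -- Multiplying the inductive expansion by z_i shifts β to β + e_i; indices not of this form have
    -- a negative entry after lowering and contribute 0.
    have hterm : ∀ i, HasSum (fun α => arensCoeff (A.curryLeft (unitVec i))
        (toIntIndex α - Finsupp.single i 1) * mono z α)
        (z i * A.curryLeft (unitVec i) fun _ => z) := by
      intro i
      have hinj : Function.Injective fun β : ℕ →₀ ℕ => β + Finsupp.single i 1 :=
        add_left_injective _
      refine (hinj.hasSum_iff fun α hα => ?_).1 ?_
      · rw [arensCoeff_eq_zero_of_neg, zero_mul]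
        intro h
        refine hα ⟨α - Finsupp.single i 1, tsub_add_cancel_of_le ?_⟩
        have := h i
        rw [Finsupp.sub_apply, toIntIndex_apply, Finsupp.single_eq_same] at this
        rw [Finsupp.single_le_iff]
        omega
      · refine ((ih (A.curryLeft (unitVec i))).mul_left (z i)).congr_fun fun β => ?_
        rw [Function.comp_apply, toIntIndex_add, toIntIndex_single, add_sub_cancel_right, mono_add,
          mono_single, pow_one]
        ring
    refine (hasSum_sum fun i _ => hterm i).congr_fun fun α => ?_
    rw [← Finset.sum_mul]
    by_cases hα : ∃ i, n ≤ i ∧ α i ≠ 0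
    · obtain ⟨i, hi, hαi⟩ := hα
      rw [mono_eq_zero hαi (hz i hi), mul_zero, mul_zero]
    · push Not at hα
      rw [arensCoeff_succ A hα]

theorem memLp_arensDiag {m : ℕ} (A : FormC m) : MemLp (arensDiag A) ∞ torusMeasure := by
  obtain ⟨C, -, hC⟩ := exists_arensDiag_bound m
  exact memLp_top_of_bound (measurable_arensDiag A).aestronglyMeasurable _
    (Eventually.of_forall (hC A))

theorem fourierCoeff_arensDiag {m : ℕ} (A : FormC m) (α : ℕ →₀ ℤ) :
    fourierCoeff ((memLp_arensDiag A).toLp _) α = arensCoeff A α := by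
  refine integral_congr_ae ?_
  filter_upwards [(memLp_arensDiag A).coeFn_toLp] with w hw
  rw [hw]

/-- The Aron–Berner extension of a polynomial as an element of `H_∞(𝕋^∞)`. -/
noncomputable def arensHardy {m : ℕ} (A : FormC m) : HInfTorus :=
  ⟨(memLp_arensDiag A).toLp _, fun α hα => by
    rw [fourierCoeff_arensDiag, arensCoeff_eq_zero_of_neg A hα]⟩

theorem hardyCoeff_arensHardy {m : ℕ} (A : FormC m) (α : ℕ →₀ ℕ) :
    hardyCoeff (arensHardy A) α = arensCoeff A (toIntIndex α) := fourierCoeff_arensDiag A _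

theorem arensHardy_mem {m : ℕ} (A : FormC m) : arensHardy A ∈ HInfTorusHom m := fun α hα => by
  by_contra h
  exact hα (by rw [hardyCoeff_arensHardy, arensCoeff_eq_zero_of_degree A h])

theorem coeFn_arensHardy {m : ℕ} (A : FormC m) :
    ((arensHardy A : LInfTorus) : Torus → ℂ) =ᵐ[torusMeasure] arensDiag A :=
  (memLp_arensDiag A).coeFn_toLp

/-- The bridge between the two descriptions: P and its Aron–Berner boundary function share
coefficients, which forces φ(ψ(P)) = P. -/
theorem isMonomialCoeff_arensHardy {m : ℕ} (A : FormC m) (P : HomPoly m)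
    (hA : ∀ x, (P : CZero → ℂ) x = A fun _ => x) :
    IsMonomialCoeff (HomPoly.toHInfBall P) (hardyCoeff (arensHardy A)) := fun n z hz => by
  have h : ((HomPoly.toHInfBall P : HInfBall) : CZeroBall →ᵇ ℂ) z = A fun _ => (z : CZero) := hA z
  rw [h]
  refine (hasSum_arensCoeff A hz).congr_fun fun α => ?_
  rw [hardyCoeff_arensHardy]
  rfl

end AronBerner

/-! ### Polarization -/

section Polarization

variable {E : Type*} [NormedAddCommGroup E] [NormedSpace ℂ E] {m : ℕ}

/-- The symmetrization of a multilinear form. -/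
noncomputable def symmetrize (A : ContinuousMultilinearMap ℂ (fun _ : Fin m => E) ℂ) :
    ContinuousMultilinearMap ℂ (fun _ : Fin m => E) ℂ :=
  (m.factorial : ℂ)⁻¹ • ∑ σ : Equiv.Perm (Fin m), A.domDomCongr σ

theorem symmetrize_apply (A : ContinuousMultilinearMap ℂ (fun _ : Fin m => E) ℂ) (x : Fin m → E) :
    symmetrize A x = (m.factorial : ℂ)⁻¹ * ∑ σ : Equiv.Perm (Fin m), A fun i => x (σ i) := by
  simp [symmetrize]

theorem symmetrize_perm (A : ContinuousMultilinearMap ℂ (fun _ : Fin m => E) ℂ)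
    (σ : Equiv.Perm (Fin m)) (x : Fin m → E) :
    symmetrize A (fun i => x (σ i)) = symmetrize A x := by
  rw [symmetrize_apply, symmetrize_apply]
  congr 1
  exact Equiv.sum_comp (Equiv.mulLeft σ) fun τ : Equiv.Perm (Fin m) => A fun i => x (τ i)

theorem symmetrize_diag (A : ContinuousMultilinearMap ℂ (fun _ : Fin m => E) ℂ) (x : E) :
    symmetrize A (fun _ => x) = A fun _ => x := by
  rw [symmetrize_apply]
  simp only [Finset.sum_const, Finset.card_univ, Fintype.card_perm, Fintype.card_fin, nsmul_eq_mul]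
  rw [inv_mul_cancel_left₀]
  exact_mod_cast m.factorial_ne_zero

/-- Inclusion–exclusion: expanding the right side over maps r from `Fin m` to itself, the signs sum
over all T disjoint from the range of r. They cancel unless r is onto, hence a permutation. -/
theorem polarization (A : ContinuousMultilinearMap ℂ (fun _ : Fin m => E) ℂ) (x : Fin m → E) :
    ∑ σ : Equiv.Perm (Fin m), A (fun i => x (σ i)) =
      ∑ T : Finset (Fin m), (-1 : ℂ) ^ T.card * A fun _ => ∑ i ∈ Tᶜ, x i := by
  classical
  have h1 : ∀ T : Finset (Fin m), (A fun _ => ∑ i ∈ Tᶜ, x i) =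
      ∑ r : Fin m → Fin m, if ∀ i, r i ∉ T then A (fun i => x (r i)) else 0 := by
    intro T
    rw [A.map_sum_finset (fun _ i => x i) fun _ => Tᶜ, ← Finset.sum_filter]
    refine Finset.sum_congr ?_ fun _ _ => rfl
    ext r
    simp
  simp_rw [h1, Finset.mul_sum]
  rw [Finset.sum_comm]
  have h2 : ∀ r : Fin m → Fin m,
      ∑ T : Finset (Fin m), (-1 : ℂ) ^ T.card * (if ∀ i, r i ∉ T then A (fun i => x (r i)) else 0) =
      if Function.Bijective r then A (fun i => x (r i)) else 0 := by
    intro r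
    have h3 : ∑ T ∈ ((Finset.univ.image r)ᶜ).powerset, (-1 : ℂ) ^ T.card =
        if (Finset.univ.image r)ᶜ = ∅ then 1 else 0 := by
      have := Finset.sum_powerset_neg_one_pow_card (x := (Finset.univ.image r)ᶜ)
      exact_mod_cast congr_arg (Int.cast : ℤ → ℂ) this
    have h4 : ((Finset.univ.image r)ᶜ).powerset =
        Finset.univ.filter fun T : Finset (Fin m) => ∀ i, r i ∉ T := by
      ext T
      simp only [Finset.mem_powerset, Finset.mem_filter, Finset.mem_univ, true_and]
      constructor
      · intro h i hi
        have := h hi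
        simp at this
      · intro h a ha
        simp only [Finset.mem_compl, Finset.mem_image, Finset.mem_univ, true_and, not_exists]
        rintro i rfl
        exact h i ha
    have h5 : (Finset.univ.image r)ᶜ = ∅ ↔ Function.Bijective r := by
      rw [Finset.compl_eq_empty_iff, ← Finite.surjective_iff_bijective]
      simp [Finset.eq_univ_iff_forall, Function.Surjective]
    simp_rw [mul_ite, mul_zero]
    rw [← Finset.sum_filter, ← h4, ← Finset.sum_mul, h3]
    simp only [h5]
    split_ifs <;> simp
  rw [Finset.sum_congr rfl fun r _ => h2 r, ← Finset.sum_filter]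
  refine Finset.sum_bij (fun σ _ => (σ : Fin m → Fin m)) (fun σ _ => ?_) (fun σ _ τ _ h => ?_)
    (fun r hr => ?_) fun σ _ => rfl
  · exact Finset.mem_filter.2 ⟨Finset.mem_univ _, σ.bijective⟩
  · exact Equiv.coe_fn_injective h
  · exact ⟨Equiv.ofBijective r (Finset.mem_filter.1 hr).2, Finset.mem_univ _, rfl⟩

/-- The polarization inequality. -/
theorem norm_symmetrize_apply_le {A : ContinuousMultilinearMap ℂ (fun _ : Fin m => E) ℂ} {M : ℝ}
    (hM : ∀ y : E, ‖y‖ < 1 → ‖A fun _ => y‖ ≤ M) (x : Fin m → E) :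
    ‖symmetrize A x‖ ≤ 2 ^ m * M * (m + 1) ^ m * ∏ i, ‖x i‖ := by
  have hm : (0 : ℝ) < m + 1 := by positivity
  have hM0 : 0 ≤ M := (norm_nonneg _).trans (hM 0 (by simp))
  -- With this bound every partial sum of the x_i has norm at most m/(m+1) < 1, and 2^m counts the
  -- subsets. Rescaling general vectors to this size costs the factor (m+1)^m.
  have hsmall : ∀ x : Fin m → E, (∀ i, ‖x i‖ ≤ (m + 1 : ℝ)⁻¹) → ‖symmetrize A x‖ ≤ 2 ^ m * M := by
    intro x hx
    rw [symmetrize_apply, polarization, norm_mul, norm_inv, Complex.norm_natCast]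
    have h1 : ‖∑ T : Finset (Fin m), (-1 : ℂ) ^ T.card * A fun _ => ∑ i ∈ Tᶜ, x i‖ ≤ 2 ^ m * M := by
      refine (norm_sum_le_of_le (f := fun T : Finset (Fin m) =>
        (-1 : ℂ) ^ T.card * A fun _ => ∑ i ∈ Tᶜ, x i) _ (n := fun _ => M) fun T _ => ?_).trans_eq ?_
      · rw [norm_mul, norm_pow, norm_neg, norm_one, one_pow, one_mul]
        refine hM _ ?_
        calc ‖∑ i ∈ Tᶜ, x i‖ ≤ ∑ i ∈ Tᶜ, (m + 1 : ℝ)⁻¹ := norm_sum_le_of_le _ fun i _ => hx i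
          _ ≤ ∑ i : Fin m, (m + 1 : ℝ)⁻¹ :=
            Finset.sum_le_sum_of_subset_of_nonneg (Finset.subset_univ _) fun _ _ _ => by positivity
          _ = m / (m + 1) := by simp [div_eq_mul_inv]
          _ < 1 := by rw [div_lt_one hm]; linarith
      · simp
    have h2 : (m.factorial : ℝ)⁻¹ ≤ 1 := inv_le_one_of_one_le₀ (by exact_mod_cast m.factorial_pos)
    calc (m.factorial : ℝ)⁻¹ * _ ≤ 1 * (2 ^ m * M) := by gcongr
      _ = _ := one_mul _
  by_cases hx : ∃ i, x i = 0
  · obtain ⟨i, hi⟩ := hx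
    rw [(symmetrize A).map_coord_zero i hi, norm_zero]
    positivity
  · push Not at hx
    have hx' : ∀ i, ‖x i‖ ≠ 0 := fun i => norm_ne_zero_iff.2 (hx i)
    set y : Fin m → E := fun i => (((m + 1) * ‖x i‖ : ℝ) : ℂ)⁻¹ • x i with hy
    have hxy : x = fun i => (((m + 1) * ‖x i‖ : ℝ) : ℂ) • y i := by
      funext i
      have : (((m + 1) * ‖x i‖ : ℝ) : ℂ) ≠ 0 := by
        exact_mod_cast mul_ne_zero hm.ne' (hx' i)
      rw [hy, smul_inv_smul₀ this]
    have hyn : ∀ i, ‖y i‖ ≤ (m + 1 : ℝ)⁻¹ := fun i => by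
      rw [hy, norm_smul, norm_inv, Complex.norm_of_nonneg (by positivity)]
      have := hx' i
      field_simp
      exact le_rfl
    have h1 : symmetrize A x = (∏ i, (((m + 1) * ‖x i‖ : ℝ) : ℂ)) * symmetrize A y := by
      conv_lhs => rw [hxy]
      rw [ContinuousMultilinearMap.map_smul_univ, smul_eq_mul]
    rw [h1, norm_mul, norm_prod]
    have h2 : ∏ i, ‖(((m + 1) * ‖x i‖ : ℝ) : ℂ)‖ = (m + 1) ^ m * ∏ i, ‖x i‖ := by
      rw [Finset.prod_congr rfl fun i _ => Complex.norm_of_nonneg (by positivity :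
        (0 : ℝ) ≤ (m + 1) * ‖x i‖), Finset.prod_mul_distrib]
      simp
    rw [h2]
    calc (m + 1 : ℝ) ^ m * (∏ i, ‖x i‖) * ‖symmetrize A y‖
        ≤ (m + 1 : ℝ) ^ m * (∏ i, ‖x i‖) * (2 ^ m * M) := by gcongr; exact hsmall y hyn
      _ = _ := by ring

/-- A uniformly bounded sequence of multilinear forms has a cluster point for pointwise
convergence. -/
theorem exists_multilinear_limit {A : ℕ → ContinuousMultilinearMap ℂ (fun _ : Fin m => E) ℂ} {C : ℝ}
    (hC : ∀ n x, ‖A n x‖ ≤ C * ∏ i, ‖x i‖) :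
    ∃ B : ContinuousMultilinearMap ℂ (fun _ : Fin m => E) ℂ,
      ∀ x a, Tendsto (fun n => A n x) atTop (𝓝 a) → B x = a := by
  set u : Ultrafilter ℕ := Ultrafilter.of atTop with hu
  have hex : ∀ x : Fin m → E, ∃ a : ℂ, Tendsto (fun n => A n x) u (𝓝 a) := by
    intro x
    obtain ⟨a, -, ha⟩ := (isCompact_closedBall (0 : ℂ) (C * ∏ i, ‖x i‖)).ultrafilter_le_nhds
      (u.map fun n => A n x) (by
        rw [le_principal_iff]
        refine Filter.mem_map.2 (Filter.univ_mem' fun n => ?_)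
        rw [mem_preimage, mem_closedBall_zero_iff]
        exact hC n x)
    exact ⟨a, ha⟩
  choose B hB using hex
  let B' : MultilinearMap ℂ (fun _ : Fin m => E) ℂ :=
    { toFun := B
      map_update_add' := fun x i y z => by
        refine tendsto_nhds_unique (hB _) (((hB _).add (hB _)).congr fun n => ?_)
        exact ((A n).map_update_add _ _ _ _).symm
      map_update_smul' := fun x i c y => by
        refine tendsto_nhds_unique (hB _) (((hB _).const_smul c).congr fun n => ?_)
        exact ((A n).map_update_smul _ _ _ _).symm }
  refine ⟨B'.mkContinuous C fun x => ?_, fun x a ha => ?_⟩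
  · exact le_of_tendsto (hB x).norm (Eventually.of_forall fun n => hC n x)
  · exact tendsto_nhds_unique (hB x) (ha.mono_left (Ultrafilter.of_le _))

end Polarization

/-! ### Homogeneous holomorphic functions are polynomials -/

section Homogeneous

variable {m : ℕ}

/-- Listing the indices of α with multiplicity gives m coordinate functionals, whose product is the
form. -/
theorem exists_form_mono {α : ℕ →₀ ℕ} (hα : α.degree = m) :
    ∃ A : FormC m, ∀ x : CZero, (A fun _ => x) = mono x α := by
  set l : List ℕ := (Finsupp.toMultiset α).toList with hl
  have hlen : l.length = m := by
    rw [hl, Multiset.length_toList, Finsupp.card_toMultiset, ← hα]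
    rfl
  subst hlen
  refine ⟨(ContinuousMultilinearMap.mkPiAlgebraFin ℂ l.length ℂ).compContinuousLinearMap
    fun j => coord (l.get j), fun x => ?_⟩
  rw [ContinuousMultilinearMap.compContinuousLinearMap_apply,
    ContinuousMultilinearMap.mkPiAlgebraFin_apply]
  have h1 : List.ofFn (fun j => coord (l.get j) x) = l.map x := by
    exact List.ofFn_getElem_eq_map l x
  rw [h1, hl, ← Multiset.prod_coe, ← Multiset.map_coe, Multiset.coe_toList, Finsupp.toMultiset_map,
    Finsupp.prod_toMultiset,
    Finsupp.prod_mapDomain_index (fun _ => pow_zero _) fun _ _ _ => pow_add _ _ _]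
  rfl

/-- Truncated to n variables, g is a finite sum of monomials of degree m, bounded by ‖g‖.
Polarization bounds the symmetrized forms uniformly in n, and a cluster point has g as its diagonal
because g is continuous and truncations converge. -/
theorem exists_homPoly_of_coeff {g : HInfBall} {c : (ℕ →₀ ℕ) → ℂ} (hg : IsMonomialCoeff g c)
    (hc : ∀ α, c α ≠ 0 → α.degree = m) : ∃ P : HomPoly m, HomPoly.toHInfBall P = g := by
  classical
  obtain ⟨G, hGd, hG⟩ := g.2
  have hGM : ∀ x ∈ Metric.ball (0 : CZero) 1, ‖G x‖ ≤ ‖(g : CZeroBall →ᵇ ℂ)‖ := fun x hx => by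
    rw [hG ⟨x, hx⟩]; exact BoundedContinuousFunction.norm_coe_le_norm _ _
  have hexp := (isMonomialCoeff_iff hG).1 hg
  have hA : ∀ α : ℕ →₀ ℕ, ∃ A : FormC m, α.degree = m → ∀ x : CZero, (A fun _ => x) = mono x α := by
    intro α
    by_cases h : α.degree = m
    · exact (exists_form_mono h).imp fun A hA _ => hA
    · exact ⟨0, fun h' => (h h').elim⟩
  choose A hA using hA
  -- The multi-indices of degree m in the first n variables; exponents are at most m, so the box
  -- below m + 1 contains them all.
  set T : ℕ → Finset (ℕ →₀ ℕ) := fun n =>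
    ((Finset.range n).finsupp fun _ => Finset.range (m + 1)).filter fun α => α.degree = m with hT
  set B : ℕ → FormC m := fun n => ∑ α ∈ T n, c α • A α with hB
  have hball : ∀ x : CZero, ‖x‖ < 1 → ∀ n, cut n x ∈ Metric.ball (0 : CZero) 1 := fun x hx n =>
    mem_ball_zero_iff.2 ((norm_cut_coe_le n x).trans_lt hx)
  have hBdiag : ∀ n (x : CZero), ‖x‖ < 1 → (B n fun _ => x) = G (cut n x) := by
    intro n x hx
    have h1 := hexp n (cut n x) (hball x hx n) fun i hi => by rw [cut_apply, if_neg (not_lt.2 hi)]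
    have h2 : HasSum (fun α => c α * mono (cut n x) α) (∑ α ∈ T n, c α * mono (cut n x) α) := by
      refine hasSum_sum_of_ne_finset_zero fun α hα => ?_
      by_cases hcα : c α = 0
      · rw [hcα, zero_mul]
      have hdeg := hc α hcα
      rw [mono_cut, if_neg, mul_zero]
      intro hsupp
      refine hα (Finset.mem_filter.2 ⟨Finset.mem_finsupp_iff.2 ⟨fun i hi => ?_, fun i _ => ?_⟩, hdeg⟩)
      · rw [Finset.mem_range]
        by_contra hin
        exact Finsupp.mem_support_iff.1 hi (hsupp i (not_lt.1 hin))
      · rw [Finset.mem_range, ← hdeg]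
        exact Nat.lt_succ_of_le (Finsupp.le_degree i α)
    rw [h1.unique h2]
    simp only [hB, sum_apply, smul_apply,
      smul_eq_mul]
    refine Finset.sum_congr rfl fun α hα => ?_
    obtain ⟨hα1, hα2⟩ := Finset.mem_filter.1 hα
    rw [hA α hα2, mono_cut, if_pos]
    intro i hi
    by_contra h
    have := (Finset.mem_finsupp_iff.1 hα1).1 (Finsupp.mem_support_iff.2 h)
    rw [Finset.mem_range] at this
    omega
  obtain ⟨L, hL⟩ := exists_multilinear_limit (A := fun n => symmetrize (B n)) fun n x =>
    norm_symmetrize_apply_le (M := ‖(g : CZeroBall →ᵇ ℂ)‖) (fun y hy => by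
      rw [hBdiag n y hy]; exact hGM _ (hball y hy n)) x
  have hLG : ∀ x : CZeroBall, (L fun _ => (x : CZero)) = G x := by
    intro x
    have hx := mem_ball_zero_iff.1 x.2
    refine hL _ _ ?_
    simp_rw [symmetrize_diag, hBdiag _ _ hx]
    exact ((hGd.differentiableAt (Metric.isOpen_ball.mem_nhds x.2)).continuousAt.tendsto).comp
      (tendsto_cut (x : CZero))
  refine ⟨⟨fun x => L fun _ => x, L, fun _ => rfl⟩, ?_⟩
  refine Subtype.ext (BoundedContinuousFunction.ext fun x => ?_)
  exact (hLG x).trans (hG x)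

theorem HomPoly.apply_smul (P : HomPoly m) (c : ℂ) (x : CZero) :
    (P : CZero → ℂ) (c • x) = c ^ m * (P : CZero → ℂ) x := by
  obtain ⟨P, A, hA⟩ := P
  change P (c • x) = c ^ m * P x
  rw [hA, hA]
  have := A.map_smul_univ (fun _ => c) fun _ => x
  simpa using this

/-- The restriction of polynomials to the ball as a linear map. -/
noncomputable def HomPoly.restrict (m : ℕ) : HomPoly m →ₗ[ℂ] HInfBall where
  toFun := HomPoly.toHInfBall
  map_add' _ _ := Subtype.ext (BoundedContinuousFunction.ext fun _ => rfl)
  map_smul' _ _ := Subtype.ext (BoundedContinuousFunction.ext fun _ => rfl)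

/-- By homogeneity a polynomial is determined on the ball: scaling by 1/(‖x‖ + 1) brings any x
inside. -/
theorem HomPoly.toHInfBall_injective :
    Function.Injective (HomPoly.toHInfBall : HomPoly m → HInfBall) := by
  intro P Q h
  refine Subtype.ext (funext fun x => ?_)
  have hball : ∀ y : CZeroBall, (P : CZero → ℂ) y = (Q : CZero → ℂ) y := fun y =>
    congr_arg (fun g : HInfBall => (g : CZeroBall →ᵇ ℂ) y) h
  set t : ℂ := ((‖x‖ + 1 : ℝ) : ℂ) with ht
  have ht0 : t ≠ 0 := by
    rw [ht]; exact_mod_cast (by positivity : ‖x‖ + 1 ≠ 0)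
  have hx : t⁻¹ • x ∈ Metric.ball (0 : CZero) 1 := by
    rw [mem_ball_zero_iff, norm_smul, norm_inv, ht, Complex.norm_of_nonneg (by positivity),
      inv_mul_lt_one₀ (by positivity)]
    linarith
  have h1 := hball ⟨_, hx⟩
  have h2 : x = t • (t⁻¹ • x) := (smul_inv_smul₀ ht0 x).symm
  rw [h2, HomPoly.apply_smul, HomPoly.apply_smul Q]
  exact congr_arg (fun a => t ^ m * a) h1

end Homogeneous

end PolyHardy

/-! ### The isometry and its polynomial part -/

open PolyHardy

theorem proposition4p6 :
    ∃ φ : PolyHardy.HInfTorus ≃ₗᵢ[ℂ] PolyHardy.HInfBall,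
      (∀ f : PolyHardy.HInfTorus,
        PolyHardy.IsMonomialCoeff (φ f) (PolyHardy.hardyCoeff f)) ∧
      (∀ φ' : PolyHardy.HInfTorus → PolyHardy.HInfBall,
        (∀ f : PolyHardy.HInfTorus,
          PolyHardy.IsMonomialCoeff (φ' f) (PolyHardy.hardyCoeff f)) →
        ∀ f, φ' f = φ f) ∧
      ∀ m : ℕ, ∃ ψ : PolyHardy.HomPoly m ≃ₗ[ℂ] PolyHardy.HInfTorusHom m,
        (∀ P : PolyHardy.HomPoly m, ∃ Q : PolyHardy.EllInf → ℂ,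
          PolyHardy.IsAronBernerExtension P Q ∧
          (((ψ P : PolyHardy.HInfTorus) : PolyHardy.LInfTorus) : PolyHardy.Torus → ℂ)
            =ᵐ[PolyHardy.torusMeasure] fun w => Q (PolyHardy.Torus.toEllInf w)) ∧
        (∀ P : PolyHardy.HomPoly m, φ (ψ P : PolyHardy.HInfTorus) = PolyHardy.HomPoly.toHInfBall P) ∧
        (∀ f : PolyHardy.HInfTorusHom m,
          φ (f : PolyHardy.HInfTorus) = PolyHardy.HomPoly.toHInfBall (ψ.symm f)) := by
  obtain ⟨φ, hφ⟩ := exists_linearIsometryEquiv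
  refine ⟨φ, hφ, fun φ' hφ' f => (hφ' f).eq (hφ f), fun m => ?_⟩
  have hform : ∀ P : HomPoly m, ∃ A : FormC m,
      (∀ (σ : Equiv.Perm (Fin m)) (x : Fin m → CZero), A (fun i => x (σ i)) = A x) ∧
        ∀ x : CZero, (P : CZero → ℂ) x = A fun _ => x := fun P => by
    obtain ⟨A, hA⟩ := P.2
    exact ⟨symmetrize A, symmetrize_perm A, fun x => by rw [symmetrize_diag]; exact hA x⟩
  -- Equal coefficients identify φ⁻¹(P) with the Aron–Berner boundary function, whichever form
  -- represents P.
  have hsymm : ∀ (P : HomPoly m) (A : FormC m), (∀ x : CZero, (P : CZero → ℂ) x = A fun _ => x) →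
      φ.symm (HomPoly.toHInfBall P) = arensHardy A := fun P A hA => by
    rw [LinearIsometryEquiv.symm_apply_eq]
    exact (isMonomialCoeff_arensHardy A P hA).eq (hφ _)
  -- Defining ψ as φ⁻¹ after restriction makes linearity and the inverse relations automatic; only
  -- membership, surjectivity and the Aron–Berner formula need the preceding theory.
  let ψ₀ : HomPoly m →ₗ[ℂ] HInfTorusHom m :=
    ((φ.symm.toLinearEquiv : HInfBall →ₗ[ℂ] HInfTorus) ∘ₗ HomPoly.restrict m).codRestrict
      (HInfTorusHom m) fun P => by
        obtain ⟨A, -, hA⟩ := hform P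
        exact (hsymm P A hA).symm ▸ arensHardy_mem A
  have hψ₀ : ∀ P, (ψ₀ P : HInfTorus) = φ.symm (HomPoly.toHInfBall P) := fun P => rfl
  have hφψ₀ : ∀ P, φ (ψ₀ P : HInfTorus) = HomPoly.toHInfBall P := fun P => by
    rw [hψ₀, LinearIsometryEquiv.apply_symm_apply]
  have hbij : Function.Bijective ψ₀ := by
    refine ⟨fun P Q h => HomPoly.toHInfBall_injective ?_, fun f => ?_⟩
    · rw [← hφψ₀, ← hφψ₀, h]
    · obtain ⟨P, hP⟩ := exists_homPoly_of_coeff (m := m) (hφ f) f.2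
      refine ⟨P, Subtype.ext (φ.injective ?_)⟩
      rw [hφψ₀, hP]
  refine ⟨LinearEquiv.ofBijective ψ₀ hbij, fun P => ?_, hφψ₀, fun f => ?_⟩
  · obtain ⟨A, hAsymm, hA⟩ := hform P
    refine ⟨fun z => arens m A fun _ => z,
      ⟨A, arens m A, hAsymm, hA, isArensExtension_arens A, fun _ => rfl⟩, ?_⟩
    have h1 : (ψ₀ P : HInfTorus) = arensHardy A := hsymm P A hA
    rw [LinearEquiv.ofBijective_apply, h1]
    exact coeFn_arensHardy A
  · obtain ⟨P, rfl⟩ := (LinearEquiv.ofBijective ψ₀ hbij).surjective f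
    rw [LinearEquiv.symm_apply_apply]
    exact hφψ₀ P
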